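/- All graphs are finite and simple. For a graph $G=(V,E)$ and an edge colouring $c:E\to\{1,\dots,k\}$, the weighted degree of a vertex $v$ is $w_c(v)=\sum_{u\in N(v)}c(uv)$. For an integer $r\ge 1$, let $s_r(G)$ be the least $k$ for which there is a (not necessarily proper) edge colouring $c:E\to\{1,\dots,k\}$ such that $w_c(u)\ne w_c(v)$ for any two distinct vertices $u,v$ at distance at most $r$ in $G$ (with $s_r(G)=\infty$ if there is no such $k$, and $s_r(G)=0$ if $G$ has no edges). Let $\Delta$ and $\delta$ denote the maximum and the minimum degree of $G$. Theorem. Let $r\ge 2$ be an integer. (1) There is a constant $\Delta_0$, depending only on $r$, such that every graph $G$ with $\Delta\ge\Delta_0$ and $\delta\ge(\ln\Delta)^8$ satisfies $$s_r(G)<4\Delta^{r-1}\left(1+\frac{1}{\ln\Delta}\right)+12 .$$ (2) Consequently $s_r(G)\le(4+o(1))\Delta^{r-1}$ for all graphs $G$ with $\delta\ge(\ln\Delta)^8$ and without isolated edges (edges both of whose ends have degree $1$); that is, there is a function $\varepsilon:\mathbb{N}\to\mathbb{R}$, depending only on $r$, with $\varepsilon(n)\to 0$ as $n\to\infty$, such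 that every such graph $G$ satisfies $s_r(G)\le(4+\varepsilon(\Delta))\Delta^{r-1}$. (For edgeless graphs, where $\Delta=0$, the degree condition is regarded as satisfied.) -/

import Mathlib

universe u

namespace SimpleGraph

/-- The weighted degree of `v`: the sum of the colours of the edges incident with `v`.
A colouring of the edges is a function on `Sym2 V` of which only the values on edges matter. -/
def weightedDegree {V : Type*} [Fintype V] (G : SimpleGraph V) [DecidableRel G.Adj]
    (c : Sym2 V → ℕ) (v : V) : ℕ :=
  ∑ u ∈ G.neighborFinset v, c s(v, u)

/-- Two distinct vertices at distance at most `r`. The extended distance is used, so vertices in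
different components are never `r`-neighbours. -/
def IsDistantNeighbor {V : Type*} (G : SimpleGraph V) (r : ℕ) (u v : V) : Prop :=
  u ≠ v ∧ G.edist u v ≤ (r : ℕ∞)

/-- `c` colours the edges of `G` with the colours `1, …, k` and any two `r`-neighbours have
different weighted degrees. -/
def IsDistantIrregularColoring {V : Type*} [Fintype V] (G : SimpleGraph V) [DecidableRel G.Adj]
    (r k : ℕ) (c : Sym2 V → ℕ) : Prop :=
  (∀ e ∈ G.edgeSet, 1 ≤ c e ∧ c e ≤ k) ∧
    ∀ u v : V, G.IsDistantNeighbor r u v → G.weightedDegree c u ≠ G.weightedDegree c v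

/-- The `r`-distant irregularity strength `s_r(G)`: the least `k` for which there is an edge
colouring with colours `1, …, k` distinguishing all `r`-neighbours, and `⊤` if there is none. -/
noncomputable def distantIrregularityStrength {V : Type*} [Fintype V] (G : SimpleGraph V)
    [DecidableRel G.Adj] (r : ℕ) : ℕ∞ :=
  sInf {s : ℕ∞ | ∃ k : ℕ, s = (k : ℕ∞) ∧
    ∃ c : Sym2 V → ℕ, G.IsDistantIrregularColoring r k c}

/-- No connected component is a single edge: every edge has an end of degree at least two. -/
def NoIsolatedEdges {V : Type*} [Fintype V] (G : SimpleGraph V) [DecidableRel G.Adj] : Prop :=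
  ∀ u v : V, G.Adj u v → 2 ≤ G.degree u ∨ 2 ≤ G.degree v

end SimpleGraph

/-! Put P = Δ^(r-1), so that a vertex of degree d has at most dP vertices within distance r. All
edges start at K + 1, with K slightly above 2P, and the vertices are handled one by one in the
manner of Kalkowski: a handled vertex v reserves the pair {a v, a v + K} and may later be toggled
within it. Toggling the b handled neighbours of a new vertex makes its weight run through b + 1
terms of step K. Small increases, at most 4μ, of the edges into a reserved last part of the vertices
fill the gaps, so about Kb consecutive weights are reachable. Half of them lie in the lower halves
of blocks of length 2K; there distinct values give disjoint pairs. In a random order a vertex with b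
earlier neighbours has at most about Pb earlier r-neighbours, so Kb/2 > Pb suffices. The edge
weights fill K + 1 ± K, up to 4μ, whence 4P.

The last part has nothing left for fine tuning. Blocks whose number is divisible by q are reserved
for it, which costs a factor q/(q-1) in K. The small increases are moreover chosen so that a vertex
of the last part, when its weight becomes final modulo K, is congruent to few r-neighbours finalised
before (`exists_shift_isSpreadList`). In a second phase its weight moves only by multiples of K, so
only those few values are to be avoided (`exists_adjust_list`).

The order comes from a random colouring with N ≈ (ln Δ)^3 colours. Hoeffding's inequality with
deviation d/N fails with probability exp(-2d/N²), and d ≥ (ln Δ)^8 puts this below every fixed power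
of 1/Δ, so the local lemma applies (`exists_balanced_coloring`). For bounded Δ in the second claim,
weights that are powers of two encode the colours seen around each vertex. -/

/-! ### The local lemma and balanced random colourings -/

open MeasureTheory ProbabilityTheory in
/-- The symmetric Lovász local lemma. -/
theorem measureReal_iInter_compl_pos_of_local {Ω ι : Type*} [MeasurableSpace Ω] [DecidableEq ι]
    (μ : Measure Ω) [IsProbabilityMeasure μ] (A : ι → Set Ω) (hA : ∀ i, MeasurableSet (A i))
    (dep : ι → Finset ι) (D : ℕ) (hD : ∀ i, (dep i).card ≤ D) (hD1 : 1 ≤ D) (p : ℝ)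
    (hp : ∀ i, μ.real (A i) ≤ p) (hp0 : 0 ≤ p) (h4 : 4 * p * D ≤ 1)
    (hind : ∀ i (S : Finset ι), i ∉ S → Disjoint S (dep i) →
      μ.real (A i ∩ ⋂ j ∈ S, (A j)ᶜ) = μ.real (A i) * μ.real (⋂ j ∈ S, (A j)ᶜ))
    (S : Finset ι) : 0 < μ.real (⋂ j ∈ S, (A j)ᶜ) := by
  have hmono : ∀ S T : Finset ι, S ⊆ T → (⋂ j ∈ T, (A j)ᶜ) ⊆ ⋂ j ∈ S, (A j)ᶜ := fun S T h =>
    Set.biInter_subset_biInter_left h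
  have hmeas : ∀ S : Finset ι, MeasurableSet (⋂ j ∈ S, (A j)ᶜ) := fun S =>
    S.measurableSet_biInter fun j _ => (hA j).compl
  -- The conditional bound P(A i | no A j with j ∈ S) ≤ 2p, multiplied out so that the conditioning
  -- event need not be known to have positive measure.
  have key : ∀ n, ∀ S : Finset ι, S.card = n → ∀ i ∉ S,
      μ.real (A i ∩ ⋂ j ∈ S, (A j)ᶜ) ≤ 2 * p * μ.real (⋂ j ∈ S, (A j)ᶜ) := by
    intro n
    induction n using Nat.strong_induction_on with
    | _ n ih =>
      intro S hS i hi
      have hB0 : 0 ≤ μ.real (⋂ j ∈ S, (A j)ᶜ) := measureReal_nonneg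
      by_cases hdis : Disjoint S (dep i)
      · rw [hind i S hi hdis]
        nlinarith [hp i]
      · set T := S \ dep i with hT
        have hTS : T ⊆ S := Finset.sdiff_subset
        have hTn : T.card < n := by
          rw [← hS]
          apply Finset.card_lt_card
          refine ⟨hTS, fun h => hdis ?_⟩
          rw [Finset.disjoint_left]
          intro a ha
          exact (Finset.mem_sdiff.1 (h ha)).2
        have h1 : μ.real (A i ∩ ⋂ j ∈ S, (A j)ᶜ) ≤ p * μ.real (⋂ j ∈ T, (A j)ᶜ) := by
          calc μ.real (A i ∩ ⋂ j ∈ S, (A j)ᶜ) ≤ μ.real (A i ∩ ⋂ j ∈ T, (A j)ᶜ) :=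
                measureReal_mono (Set.inter_subset_inter_right _ (hmono _ _ hTS))
            _ = μ.real (A i) * μ.real (⋂ j ∈ T, (A j)ᶜ) :=
                hind i T (fun h => hi (hTS h)) Finset.sdiff_disjoint
            _ ≤ _ := mul_le_mul_of_nonneg_right (hp i) measureReal_nonneg
        have h2 : μ.real (⋂ j ∈ T, (A j)ᶜ) ≤ μ.real (⋂ j ∈ S, (A j)ᶜ) +
            ∑ j ∈ S ∩ dep i, μ.real (A j ∩ ⋂ k ∈ T, (A k)ᶜ) := by
          have hsub : (⋂ j ∈ T, (A j)ᶜ) ⊆ (⋂ j ∈ S, (A j)ᶜ) ∪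
              ⋃ j ∈ S ∩ dep i, (A j ∩ ⋂ k ∈ T, (A k)ᶜ) := by
            intro x hx
            by_cases hxS : ∃ j ∈ S, x ∈ A j
            · obtain ⟨j, hj, hxj⟩ := hxS
              right
              have hjd : j ∈ dep i := by
                by_contra hjd
                have := Set.mem_iInter₂.1 hx j (Finset.mem_sdiff.2 ⟨hj, hjd⟩)
                exact this hxj
              exact Set.mem_biUnion (Finset.mem_coe.2 (Finset.mem_inter.2 ⟨hj, hjd⟩)) ⟨hxj, hx⟩
            · left
              push Not at hxS
              exact Set.mem_iInter₂.2 fun j hj => hxS j hj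
          refine (measureReal_mono hsub).trans ((measureReal_union_le _ _).trans ?_)
          gcongr
          exact measureReal_biUnion_finset_le _ _
        have h3 : ∑ j ∈ S ∩ dep i, μ.real (A j ∩ ⋂ k ∈ T, (A k)ᶜ) ≤
            D * (2 * p * μ.real (⋂ k ∈ T, (A k)ᶜ)) := by
          calc _ ≤ ∑ j ∈ S ∩ dep i, 2 * p * μ.real (⋂ k ∈ T, (A k)ᶜ) := by
                refine Finset.sum_le_sum fun j hj => ih _ hTn T rfl j ?_
                exact fun h => (Finset.mem_sdiff.1 h).2 (Finset.mem_inter.1 hj).2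
            _ = (S ∩ dep i).card * (2 * p * μ.real (⋂ k ∈ T, (A k)ᶜ)) := by
                rw [Finset.sum_const, nsmul_eq_mul]
            _ ≤ _ := by
                have : ((S ∩ dep i).card : ℝ) ≤ D := by
                  exact_mod_cast (Finset.card_le_card Finset.inter_subset_right).trans (hD i)
                have h0 : 0 ≤ μ.real (⋂ k ∈ T, (A k)ᶜ) := measureReal_nonneg
                gcongr
        have h0 : 0 ≤ μ.real (⋂ k ∈ T, (A k)ᶜ) := measureReal_nonneg
        -- By 4pD ≤ 1 the dependent events remove at most half of the mass, which is the factor 2 in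
        -- `key`.
        have h5 : D * (2 * p * μ.real (⋂ k ∈ T, (A k)ᶜ)) ≤ 1 / 2 * μ.real (⋂ k ∈ T, (A k)ᶜ) := by
          nlinarith
        nlinarith
  have hp2 : 2 * p < 1 := by
    have : (1 : ℝ) ≤ D := by exact_mod_cast hD1
    nlinarith
  induction S using Finset.induction_on with
  | empty => simp
  | insert j S hj ih =>
    have h1 := key _ S rfl j hj
    have h2 : μ.real (⋂ k ∈ S, (A k)ᶜ) ≤ μ.real (⋂ k ∈ insert j S, (A k)ᶜ) +
        μ.real (A j ∩ ⋂ k ∈ S, (A k)ᶜ) := by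
      refine (measureReal_mono ?_).trans (measureReal_union_le _ _)
      intro x hx
      by_cases hxj : x ∈ A j
      · exact Or.inr ⟨hxj, hx⟩
      · left
        rw [Finset.set_biInter_insert]
        exact ⟨hxj, hx⟩
    nlinarith

open MeasureTheory ProbabilityTheory in
/-- The local lemma for events that depend on few coordinates of a random point of a finite
power. -/
theorem exists_forall_notMem_of_local {V ι β : Type*} [Fintype V] [DecidableEq V] [Fintype ι]
    [DecidableEq ι] [Finite β] [MeasurableSpace β] [MeasurableSingletonClass β]
    (ν : Measure β) [IsProbabilityMeasure ν] (A : ι → Set (V → β)) (F : ι → Finset V)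
    (hF : ∀ i f g, (∀ v ∈ F i, f v = g v) → (f ∈ A i ↔ g ∈ A i))
    (D : ℕ) (hD : ∀ i, (Finset.univ.filter fun j => ¬ Disjoint (F i) (F j)).card ≤ D) (hD1 : 1 ≤ D)
    (p : ℝ) (hp : ∀ i, (Measure.pi fun _ : V => ν).real (A i) ≤ p) (hp0 : 0 ≤ p)
    (h4 : 4 * p * D ≤ 1) : ∃ f : V → β, ∀ i, f ∉ A i := by
  classical
  have hne : Nonempty β := by
    by_contra h
    rw [not_nonempty_iff] at h
    have := measure_univ (μ := ν)
    rw [Set.univ_eq_empty_iff.2 h] at this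
    simp at this
  have hm : ∀ s : Set (V → β), MeasurableSet s := fun s => s.toFinite.measurableSet
  have hpos := measureReal_iInter_compl_pos_of_local (Measure.pi fun _ : V => ν) A
    (fun i => hm _) (fun i => Finset.univ.filter fun j => ¬ Disjoint (F i) (F j)) D hD hD1 p hp hp0 h4
    (by
      intro i S hi hS
      have hdisj : Disjoint (F i) (S.biUnion F) := by
        rw [Finset.disjoint_biUnion_right]
        intro j hj
        by_contra h
        exact Finset.disjoint_left.1 hS hj (by simpa using h)
      have hind : iIndepFun (fun (v : V) (f : V → β) => f v) (Measure.pi fun _ : V => ν) :=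
        iIndepFun_pi (X := fun _ => id) fun _ => aemeasurable_id
      have h := hind.indepFun_finset (F i) (S.biUnion F) hdisj (fun v => measurable_pi_apply v)
      obtain ⟨b⟩ := hne
      -- An event determined by the coordinates in T is a preimage under restriction to T; the
      -- filler b outside T is arbitrary.
      have hext : ∀ (T : Finset V) (B : Set (V → β)),
          (∀ f g, (∀ v ∈ T, f v = g v) → (f ∈ B ↔ g ∈ B)) →
          B = (fun (a : V → β) (i : T) => a i) ⁻¹'
            {g | (fun v => if h : v ∈ T then g ⟨v, h⟩ else b) ∈ B} := by
        intro T B hB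
        ext f
        simp only [Set.mem_preimage, Set.mem_ofPred_eq]
        exact hB _ _ fun v hv => by simp [hv]
      rw [hext (F i) (A i) (hF i), hext (S.biUnion F) (⋂ j ∈ S, (A j)ᶜ) ?_]
      · simp only [measureReal_def, ← ENNReal.toReal_mul]
        congr 1
        exact h.measure_inter_preimage_eq_mul _ _ (Set.toFinite _).measurableSet
          (Set.toFinite _).measurableSet
      · intro f g hfg
        simp only [Set.mem_iInter, Set.mem_compl_iff]
        refine forall₂_congr fun j hj => not_congr (hF j f g fun v hv => hfg v ?_)
        exact Finset.mem_biUnion.2 ⟨j, hj, hv⟩)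
    Finset.univ
  by_contra hcon
  push Not at hcon
  have : (⋂ j ∈ (Finset.univ : Finset ι), (A j)ᶜ) = ∅ := by
    ext f
    obtain ⟨i, hi⟩ := hcon f
    simp only [Set.mem_iInter, Set.mem_compl_iff, Set.mem_empty_iff_false, iff_false]
    exact fun h => h i (Finset.mem_univ _) hi
  rw [this] at hpos
  simp at hpos

open MeasureTheory ProbabilityTheory in
/-- Hoeffding's inequality for the number of coordinates of a random point that lie in a set. -/
theorem measureReal_card_filter_mem_ge_le {V β : Type*} [Fintype V] [Finite β]
    [MeasurableSpace β] [MeasurableSingletonClass β] (ν : Measure β) [IsProbabilityMeasure ν]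
    (B : Set β) [DecidablePred (· ∈ B)] (W : Finset V) (D x : ℝ) (hW : (W.card : ℝ) ≤ D)
    (hx : 0 < x) :
    (Measure.pi fun _ : V => ν).real
      {f | D * ν.real B + x ≤ ((W.filter fun u => f u ∈ B).card : ℝ)} ≤
      Real.exp (-2 * x ^ 2 / D) := by
  classical
  rcases W.eq_empty_or_nonempty with rfl | hne
  · have : {f : V → β | D * ν.real B + x ≤
        (((∅ : Finset V).filter fun u => f u ∈ B).card : ℝ)} = ∅ := by
      ext f
      simp only [Finset.filter_empty, Finset.card_empty, Nat.cast_zero, Set.mem_ofPred_eq,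
        Set.mem_empty_iff_false, iff_false, not_le]
      have : 0 ≤ D * ν.real B := mul_nonneg (by simpa using hW) measureReal_nonneg
      linarith
    rw [this]
    simpa using Real.exp_nonneg _
  have hW0 : (0 : ℝ) < W.card := by exact_mod_cast hne.card_pos
  set m := Measure.pi fun _ : V => ν with hm
  set g : β → ℝ := fun b => (if b ∈ B then 1 else 0) - ν.real B with hg
  have hms : ∀ s : Set β, MeasurableSet s := fun s => s.toFinite.measurableSet
  have hmeasg : ∀ h : β → ℝ, Measurable h := fun h s _ => hms _
  have hind : iIndepFun (fun (v : V) (f : V → β) => g (f v)) m :=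
    iIndepFun_pi (X := fun _ => g) fun _ => (hmeasg g).aemeasurable
  -- Hoeffding's lemma for a variable with values in an interval of length 1.
  have hsub : HasSubgaussianMGF g (1 / 4) ν := by
    have h := hasSubgaussianMGF_of_mem_Icc (μ := ν) (X := fun b => if b ∈ B then (1 : ℝ) else 0)
      (a := 0) (b := 1) (hmeasg _).aemeasurable
      (ae_of_all _ fun b => by by_cases h : b ∈ B <;> simp [h])
    have hint : ∫ b, (if b ∈ B then (1 : ℝ) else 0) ∂ν = ν.real B := by
      have := integral_indicator_one (μ := ν) (hms B)
      rw [← this]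
      congr 1
      ext b
      simp [Set.indicator_apply]
    rw [hint] at h
    convert h using 1
    norm_num
  have hsub' : ∀ v ∈ W, HasSubgaussianMGF (fun f : V → β => g (f v)) (1 / 4) m := by
    intro v _
    have hmap : m.map (fun f : V → β => f v) = ν := (measurePreserving_eval (fun _ : V => ν) v).map_eq
    have := HasSubgaussianMGF.of_map (μ := m) (Y := fun f : V → β => f v) (X := g) (c := 1 / 4)
      (measurable_pi_apply v).aemeasurable (by rw [hmap]; exact hsub)
    exact this
  have h := HasSubgaussianMGF.measure_sum_ge_le_of_iIndepFun hind hsub' hx.le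
  calc _ ≤ m.real {f | x ≤ ∑ v ∈ W, g (f v)} := by
        refine measureReal_mono fun f hf => ?_
        simp only [Set.mem_ofPred_eq] at hf ⊢
        rw [hg]
        simp only [Finset.sum_sub_distrib, Finset.sum_boole, Finset.sum_const, nsmul_eq_mul]
        have : (W.card : ℝ) * ν.real B ≤ D * ν.real B :=
          mul_le_mul_of_nonneg_right hW measureReal_nonneg
        linarith
    _ ≤ _ := h
    _ ≤ _ := by
        apply Real.exp_le_exp.2
        have e : (2 * ∑ _i ∈ W, ((1 / 4 : NNReal) : ℝ)) = W.card / 2 := by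
          simp [Finset.sum_const]
          ring
        push_cast at e ⊢
        rw [e, neg_div, neg_mul, neg_div, neg_le_neg_iff]
        rw [div_div_eq_mul_div, mul_comm 2]
        exact div_le_div_of_nonneg_left (by positivity) hW0 hW

open MeasureTheory ProbabilityTheory in
/-- A colouring with `N` colours in which every initial and every final segment of the colours
occupies about its fair share of each of the given sets. -/
theorem exists_balanced_coloring {V : Type*} [Fintype V] [DecidableEq V] {N : ℕ} [NeZero N]
    (W : Bool → V → Finset V) (D : Bool → V → ℝ) (hW : ∀ b v, ((W b v).card : ℝ) ≤ D b v)
    (δ : ℝ) (hδ0 : 0 < δ) (hδ : ∀ b v, δ ≤ D b v) (M : ℕ) (hM1 : 1 ≤ M)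
    (hM : ∀ v, (Finset.univ.filter fun w =>
      ¬ Disjoint (W true v ∪ W false v) (W true w ∪ W false w)).card ≤ M)
    (h4 : 4 * (4 * (N + 1) * Real.exp (-2 * δ / N ^ 2)) * M ≤ 1) :
    ∃ col : V → Fin N, ∀ b v, ∀ t ≤ N,
      (((W b v).filter fun u => (col u : ℕ) < t).card : ℝ) < D b v * (t / N) + D b v / N ∧
      (((W b v).filter fun u => t ≤ (col u : ℕ)).card : ℝ) <
        D b v * (1 - t / N) + D b v / N := by
  classical
  set ν : Measure (Fin N) := (PMF.uniformOfFintype (Fin N)).toMeasure with hν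
  have hN0 : (0 : ℝ) < N := by exact_mod_cast Nat.pos_of_ne_zero (NeZero.ne N)
  have hD0 : ∀ b v, 0 < D b v := fun b v => hδ0.trans_le (hδ b v)
  set S : Bool → ℕ → Finset (Fin N) := fun c t =>
    if c then Finset.univ.filter fun i : Fin N => (i : ℕ) < t
    else Finset.univ.filter fun i : Fin N => t ≤ (i : ℕ) with hS
  have hreal : ∀ T : Finset (Fin N), ν.real (T : Set (Fin N)) = T.card / N := by
    intro T
    rw [measureReal_def, hν, PMF.toMeasure_uniformOfFintype_apply _ T.measurableSet]
    simp
  have hcard : ∀ t ≤ N, (Finset.univ.filter fun i : Fin N => (i : ℕ) < t).card = t := by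
    intro t ht
    rw [Fin.card_filter_val_lt, min_eq_right ht]
  have hcard' : ∀ t ≤ N, (((Finset.univ.filter fun i : Fin N => t ≤ (i : ℕ)).card : ℕ) : ℝ) =
      N - t := by
    intro t ht
    have h := Finset.card_filter_add_card_filter_not (s := (Finset.univ : Finset (Fin N)))
      (fun i : Fin N => (i : ℕ) < t)
    simp only [not_lt, hcard t ht, Finset.card_univ, Fintype.card_fin] at h
    have h' : (t : ℝ) + ((Finset.univ.filter fun i : Fin N => t ≤ (i : ℕ)).card : ℕ) = N := by
      exact_mod_cast h
    linarith
  set E : Bool → V → Bool → ℕ → Set (V → Fin N) := fun b v c t =>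
    {f | D b v * ν.real (S c t : Set (Fin N)) + D b v / N ≤
      (((W b v).filter fun u => f u ∈ (S c t : Set (Fin N))).card : ℝ)} with hE
  -- The 4(N + 1) bad events at v are merged into one, so that the dependencies are indexed by
  -- vertices.
  set A : V → Set (V → Fin N) := fun v =>
    ⋃ x ∈ (Finset.univ ×ˢ Finset.univ ×ˢ Finset.range (N + 1) : Finset (Bool × Bool × ℕ)),
      E x.1 v x.2.1 x.2.2 with hA
  obtain ⟨f, hf⟩ := exists_forall_notMem_of_local ν A (fun v => W true v ∪ W false v)
    (by
      intro v f g hfg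
      have hE' : ∀ b c t, f ∈ E b v c t ↔ g ∈ E b v c t := by
        intro b c t
        have : ((W b v).filter fun u => f u ∈ (S c t : Set (Fin N))) =
            (W b v).filter fun u => g u ∈ (S c t : Set (Fin N)) := by
          refine Finset.filter_congr fun u hu => ?_
          rw [hfg u]
          cases b
          · exact Finset.mem_union_right _ hu
          · exact Finset.mem_union_left _ hu
        simp only [hE, Set.mem_ofPred_eq, this]
      simp only [hA, Set.mem_iUnion, hE'])
    M hM hM1 (4 * (N + 1) * Real.exp (-2 * δ / N ^ 2))
    (by
      intro v
      refine (measureReal_biUnion_finset_le _ _).trans ?_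
      refine (Finset.sum_le_card_nsmul _ _ (Real.exp (-2 * δ / N ^ 2)) ?_).trans ?_
      · intro x _
        refine (measureReal_card_filter_mem_ge_le ν _ _ _ _ (hW _ _)
          (div_pos (hD0 _ _) hN0)).trans (Real.exp_le_exp.2 ?_)
        have h1 := hδ x.1 v
        have h2 := hD0 x.1 v
        have : -2 * (D x.1 v / N) ^ 2 / D x.1 v = -2 * D x.1 v / N ^ 2 := by
          field_simp
        rw [this]
        gcongr ?_ / _
        linarith
      · simp only [Finset.card_product, Finset.card_univ, Fintype.card_bool, Finset.card_range,
          nsmul_eq_mul]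
        push_cast
        apply le_of_eq
        ring)
    (by positivity) h4
  refine ⟨f, fun b v t ht => ?_⟩
  have hnot : ∀ c, f ∉ E b v c t := by
    intro c hc
    refine hf v ?_
    simp only [hA, Set.mem_iUnion]
    exact ⟨(b, c, t), by simp; omega, hc⟩
  constructor
  · have := hnot true
    simp only [hE, hS, Set.mem_ofPred_eq, not_le, hreal, if_true, Finset.mem_coe,
      Finset.mem_filter, Finset.mem_univ, true_and, hcard t ht] at this
    exact this
  · have := hnot false
    simp only [hE, hS, Set.mem_ofPred_eq, not_le, hreal, Finset.mem_coe,
      Finset.mem_filter, Finset.mem_univ, true_and, hcard' t ht, Bool.false_eq_true,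
      if_false] at this
    rwa [sub_div, div_self hN0.ne'] at this

/-! ### Sizes of neighbourhoods and graphs of bounded degree -/

namespace SimpleGraph

theorem isDistantNeighbor_comm {V : Type*} (G : SimpleGraph V) {r : ℕ} {u v : V} :
    G.IsDistantNeighbor r u v ↔ G.IsDistantNeighbor r v u := by
  unfold IsDistantNeighbor
  rw [ne_comm, edist_comm]

/-- A finite graph has a vertex colouring with one colour more than a bound on its degrees. -/
theorem exists_coloring_of_card_le {V : Type*} [Fintype V] (R : V → V → Prop) (hR : ∀ u v, R u v → R v u) (D : ℕ)
    (hD : ∀ v, ∃ S : Finset V, S.card ≤ D ∧ ∀ u, R v u → u ∈ S) :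
    ∃ φ : V → Fin (D + 1), ∀ u v, u ≠ v → R u v → φ u ≠ φ v := by
  classical
  suffices h : ∀ S : Finset V, ∃ φ : V → Fin (D + 1), ∀ u ∈ S, ∀ v ∈ S, u ≠ v → R u v →
      φ u ≠ φ v by
    obtain ⟨φ, hφ⟩ := h Finset.univ
    exact ⟨φ, fun u v => hφ u (Finset.mem_univ _) v (Finset.mem_univ _)⟩
  intro S
  induction S using Finset.induction_on with
  | empty => exact ⟨fun _ => 0, by simp⟩
  | insert w S hw ih =>
    obtain ⟨φ, hφ⟩ := ih
    obtain ⟨T, hT, hT'⟩ := hD w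
    have hlt : (T.image φ).card < (Finset.univ : Finset (Fin (D + 1))).card := by
      rw [Finset.card_univ, Fintype.card_fin]
      exact (Finset.card_image_le.trans hT).trans_lt (Nat.lt_succ_self D)
    obtain ⟨i, -, hi⟩ := Finset.exists_mem_notMem_of_card_lt_card hlt
    have hi' : ∀ u, R w u → φ u ≠ i := fun u hu h =>
      hi (Finset.mem_image.2 ⟨u, hT' u hu, h⟩)
    refine ⟨Function.update φ w i, fun u hu v hv huv h => ?_⟩
    rcases Finset.mem_insert.1 hu with rfl | hu
    · rw [Function.update_self, Function.update_of_ne huv.symm]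
      exact (hi' v h).symm
    · have huw : u ≠ w := fun e => hw (e ▸ hu)
      rw [Function.update_of_ne huw]
      rcases Finset.mem_insert.1 hv with rfl | hv
      · rw [Function.update_self]
        exact hi' u (hR _ _ h)
      · rw [Function.update_of_ne (show v ≠ w from fun e => hw (e ▸ hv))]
        exact hφ u hu v hv huv h

section Balls

variable {V : Type*} [Fintype V] (G : SimpleGraph V) [DecidableRel G.Adj]

open Classical in
/-- The vertices that a path of length at most `k` from `w` avoiding a neighbour `v` can reach. -/
theorem card_filter_isPath_notMem_support_le (k : ℕ) (v w : V) (h : G.Adj v w) :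
    (Finset.univ.filter fun u => ∃ p : G.Walk w u, p.IsPath ∧ p.length ≤ k ∧ v ∉ p.support).card ≤
      G.maxDegree ^ k := by
  induction k generalizing v w with
  | zero =>
    rw [pow_zero]
    refine (Finset.card_le_card (t := {w}) fun u hu => ?_).trans (by simp)
    obtain ⟨p, -, hp, -⟩ := (Finset.mem_filter.1 hu).2
    rw [Finset.mem_singleton]
    exact (Walk.eq_of_length_eq_zero (Nat.le_zero.1 hp)).symm
  | succ k ih =>
    have hdeg : 1 ≤ G.maxDegree :=
      ((G.degree_pos_iff_exists_adj v).2 ⟨w, h⟩).trans_le (G.degree_le_maxDegree v)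
    have hsub : (Finset.univ.filter fun u =>
        ∃ p : G.Walk w u, p.IsPath ∧ p.length ≤ k + 1 ∧ v ∉ p.support) ⊆
        insert w (((G.neighborFinset w).erase v).biUnion fun x => Finset.univ.filter fun u =>
          ∃ p : G.Walk x u, p.IsPath ∧ p.length ≤ k ∧ w ∉ p.support) := by
      intro u hu
      obtain ⟨p, hp, hl, hv⟩ := (Finset.mem_filter.1 hu).2
      cases p with
      | nil => exact Finset.mem_insert_self _ _
      | @cons _ x _ hx q =>
        rw [Walk.cons_isPath_iff] at hp
        refine Finset.mem_insert_of_mem (Finset.mem_biUnion.2 ⟨x, ?_, ?_⟩)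
        · rw [Finset.mem_erase, mem_neighborFinset]
          refine ⟨?_, hx⟩
          rintro rfl
          exact hv (by simp)
        · rw [Walk.length_cons] at hl
          exact Finset.mem_filter.2 ⟨Finset.mem_univ _, q, hp.1, by omega, hp.2⟩
    -- Without backtracking there are at most Δ - 1 ways on from w, and the end w itself fits into
    -- the spare Δ^k. This keeps the bound a pure power of Δ.
    calc _ ≤ _ := Finset.card_le_card hsub
      _ ≤ _ + 1 := Finset.card_insert_le _ _
      _ ≤ ((G.neighborFinset w).erase v).card * G.maxDegree ^ k + 1 := by
          gcongr
          refine Finset.card_biUnion_le_card_mul _ _ _ fun x hx => ih w x ?_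
          exact (G.mem_neighborFinset _ _).1 (Finset.mem_of_mem_erase hx)
      _ ≤ (G.maxDegree - 1) * G.maxDegree ^ k + 1 * G.maxDegree ^ k := by
          gcongr
          · rw [Finset.card_erase_of_mem ((G.mem_neighborFinset _ _).2 h.symm),
              card_neighborFinset_eq_degree]
            exact Nat.sub_le_sub_right (G.degree_le_maxDegree w) 1
          · rw [one_mul]
            exact Nat.one_le_pow _ _ hdeg
      _ = _ := by
          rw [← add_mul, Nat.sub_add_cancel hdeg, pow_succ']

open Classical in
/-- The number of vertices at distance between `1` and `r` from a given one. -/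
theorem card_filter_isDistantNeighbor_le (r : ℕ) (hr : 1 ≤ r) (v : V) :
    (Finset.univ.filter fun u => G.IsDistantNeighbor r v u).card ≤
      G.degree v * G.maxDegree ^ (r - 1) := by
  have hsub : (Finset.univ.filter fun u => G.IsDistantNeighbor r v u) ⊆
      (G.neighborFinset v).biUnion fun x => Finset.univ.filter fun u =>
        ∃ p : G.Walk x u, p.IsPath ∧ p.length ≤ r - 1 ∧ v ∉ p.support := by
    intro u hu
    obtain ⟨hne, hd⟩ := (Finset.mem_filter.1 hu).2
    obtain ⟨p, hp⟩ := exists_walk_of_edist_ne_top (ne_top_of_le_ne_top (ENat.natCast_ne_top r) hd)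
    rw [← hp, Nat.cast_le] at hd
    have hq := p.bypass_isPath
    have hl := p.length_bypass_le_length
    generalize p.bypass = q at hq hl
    cases q with
    | nil => exact absurd rfl hne
    | @cons _ x _ hx q =>
      rw [Walk.cons_isPath_iff] at hq
      rw [Walk.length_cons] at hl
      exact Finset.mem_biUnion.2 ⟨x, (G.mem_neighborFinset _ _).2 hx,
        Finset.mem_filter.2 ⟨Finset.mem_univ _, q, hq.1, by omega, hq.2⟩⟩
  refine (Finset.card_le_card hsub).trans ?_
  rw [← card_neighborFinset_eq_degree]
  exact Finset.card_biUnion_le_card_mul _ _ _ fun x hx =>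
    G.card_filter_isPath_notMem_support_le _ v x ((G.mem_neighborFinset _ _).1 hx)

/-- Without isolated edges the distant irregularity strength is bounded in terms of the maximum
degree. -/
theorem exists_isDistantIrregularColoring_of_noIsolatedEdges (r : ℕ) (h : G.NoIsolatedEdges) :
    ∃ c : Sym2 V → ℕ, G.IsDistantIrregularColoring r
      (2 ^ Fintype.card (Sym2 (Fin (G.maxDegree * G.maxDegree ^ r + 1)))) c := by
  classical
  set D := G.maxDegree * G.maxDegree ^ r with hDdef
  -- Distance r + 1, because a neighbour of u must also be told apart from the r-neighbours of u.
  obtain ⟨φ, hφ⟩ := exists_coloring_of_card_le (G.IsDistantNeighbor (r + 1))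
    (fun u v => (G.isDistantNeighbor_comm).1) D
    (fun v => ⟨Finset.univ.filter fun u => G.IsDistantNeighbor (r + 1) v u,
      (G.card_filter_isDistantNeighbor_le (r + 1) (by omega) v).trans
        (Nat.mul_le_mul_right _ (G.degree_le_maxDegree v)), fun u hu => by simpa using hu⟩)
  set e := Fintype.equivFin (Sym2 (Fin (D + 1))) with he
  -- The edges at a vertex get distinct powers of two, so the binary expansion of its weighted
  -- degree is the set of colour pairs around it.
  set c : Sym2 V → ℕ := fun z => 2 ^ (e (z.map φ) : ℕ) with hc
  have hφ' : ∀ u v, u ≠ v → G.edist u v ≤ (r : ℕ∞) + 1 → φ u ≠ φ v := fun u v huv hd =>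
    hφ u v huv ⟨huv, by exact_mod_cast hd⟩
  refine ⟨c, fun z _ => ⟨Nat.one_le_two_pow, Nat.pow_le_pow_right (by norm_num) (e _).2.le⟩, ?_⟩
  intro u v huv heq
  have hinj : ∀ u, Set.InjOn (fun x => (e (s(u, x).map φ) : ℕ)) (G.neighborFinset u) := by
    intro u x hx y hy hxy
    have hx' : G.Adj u x := by simpa using hx
    have hy' : G.Adj u y := by simpa using hy
    have h1 : s(φ u, φ x) = s(φ u, φ y) := e.injective (Fin.ext hxy)
    rw [Sym2.congr_right] at h1
    by_contra hne
    rcases r with _ | r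
    · obtain ⟨hne', hd⟩ := huv
      exact hne' (edist_eq_zero_iff.1 (le_antisymm hd bot_le))
    refine hφ' x y hne ?_ h1
    calc G.edist x y ≤ G.edist x u + G.edist u y := G.edist_triangle
      _ ≤ 1 + 1 := add_le_add (edist_le_one_iff_adj_or_eq.2 (Or.inl hx'.symm))
          (edist_le_one_iff_adj_or_eq.2 (Or.inl hy'))
      _ ≤ ((r + 1 : ℕ) : ℕ∞) + 1 := by
          gcongr
          push_cast
          exact le_add_self
  have hw : ∀ u, G.weightedDegree c u =
      ∑ i ∈ (G.neighborFinset u).image (fun x => (e (s(u, x).map φ) : ℕ)), 2 ^ i := by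
    intro u
    rw [Finset.sum_image (hinj u)]
    rfl
  have himg : (G.neighborFinset u).image (fun x => (e (s(u, x).map φ) : ℕ)) =
      (G.neighborFinset v).image (fun x => (e (s(v, x).map φ) : ℕ)) := by
    apply Finset.geomSum_injective (le_refl 2)
    simpa only [hw] using heq
  -- The pair {φ u, φ x} also occurs at v; as φ u ≠ φ v, this forces φ x = φ v and so x = v. Used in
  -- both directions, it makes uv an isolated edge.
  have key : ∀ u v, G.IsDistantNeighbor r u v →
      (G.neighborFinset u).image (fun x => (e (s(u, x).map φ) : ℕ)) =
      (G.neighborFinset v).image (fun x => (e (s(v, x).map φ) : ℕ)) →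
      ∀ x, G.Adj u x → x = v := by
    intro u v huv himg x hx
    have hm : (e (s(u, x).map φ) : ℕ) ∈
        (G.neighborFinset v).image (fun x => (e (s(v, x).map φ) : ℕ)) := by
      rw [← himg]
      exact Finset.mem_image_of_mem _ ((G.mem_neighborFinset _ _).2 hx)
    obtain ⟨y, hy, hxy⟩ := Finset.mem_image.1 hm
    have hy' : G.Adj v y := (G.mem_neighborFinset _ _).1 hy
    have h1 : s(φ v, φ y) = s(φ u, φ x) := e.injective (Fin.ext hxy)
    have huv' : φ u ≠ φ v := hφ' u v huv.1 (huv.2.trans le_self_add)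
    rw [Sym2.eq_iff] at h1
    rcases h1 with ⟨h1, -⟩ | ⟨h1, -⟩
    · exact absurd h1.symm huv'
    · by_contra hne
      refine hφ' x v hne ?_ h1.symm
      calc G.edist x v ≤ G.edist x u + G.edist u v := G.edist_triangle
        _ ≤ 1 + r := add_le_add (edist_le_one_iff_adj_or_eq.2 (Or.inl hx.symm)) huv.2
        _ = r + 1 := add_comm _ _
  have hex : ∃ x, G.Adj u x := by
    obtain ⟨p, -⟩ := exists_walk_of_edist_ne_top
      (ne_top_of_le_ne_top (ENat.natCast_ne_top r) huv.2)
    cases p with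
    | nil => exact absurd rfl huv.1
    | cons hx _ => exact ⟨_, hx⟩
  obtain ⟨x, hx⟩ := hex
  have hu := key u v huv himg
  have hv := key v u ((G.isDistantNeighbor_comm).1 huv) himg.symm
  have hadj : G.Adj u v := hu x hx ▸ hx
  have hdeg : ∀ u v, (∀ x, G.Adj u x → x = v) → G.degree u ≤ 1 := by
    intro u v hu
    rw [← card_neighborFinset_eq_degree]
    refine (Finset.card_le_card (t := {v}) fun x hx => ?_).trans (by simp)
    exact Finset.mem_singleton.2 (hu x ((G.mem_neighborFinset _ _).1 hx))
  have h1 := hdeg u v hu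
  have h2 := hdeg v u hv
  rcases h u v hadj with h | h <;> omega

end Balls

end SimpleGraph

/-! ### Elementary changes of weights -/

namespace SimpleGraph

section Bump

variable {V : Type*} [Fintype V] [DecidableEq V] (G : SimpleGraph V) [DecidableRel G.Adj]

/-- The weighted degree for an integer edge weighting. -/
def intWeight (c : Sym2 V → ℤ) (v : V) : ℤ := ∑ u ∈ G.neighborFinset v, c s(v, u)

/-- The edge weighting with weight `δ u` on the edge `vu` and `0` on the edges not at `v`. -/
def starWeight (v : V) (δ : V → ℤ) : Sym2 V → ℤ := fun e =>
  ∑ u ∈ G.neighborFinset v, if e = s(v, u) then δ u else 0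

theorem starWeight_of_adj {v u : V} (h : G.Adj v u) (δ : V → ℤ) :
    G.starWeight v δ s(v, u) = δ u := by
  unfold starWeight
  simp only [Sym2.congr_right]
  rw [Finset.sum_ite_eq, if_pos ((G.mem_neighborFinset _ _).2 h)]

theorem starWeight_of_ne {v x y : V} (hx : x ≠ v) (hy : y ≠ v) (δ : V → ℤ) :
    G.starWeight v δ s(x, y) = 0 := by
  refine Finset.sum_eq_zero fun u _ => if_neg fun h => ?_
  rcases Sym2.eq_iff.1 h with ⟨h, -⟩ | ⟨-, h⟩
  · exact hx h
  · exact hy h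

theorem intWeight_add_starWeight_self (c : Sym2 V → ℤ) (v : V) (δ : V → ℤ) :
    G.intWeight (c + G.starWeight v δ) v = G.intWeight c v + ∑ u ∈ G.neighborFinset v, δ u := by
  unfold intWeight
  rw [← Finset.sum_add_distrib]
  refine Finset.sum_congr rfl fun u hu => ?_
  rw [Pi.add_apply, G.starWeight_of_adj ((G.mem_neighborFinset _ _).1 hu)]

theorem intWeight_add_starWeight_of_ne (c : Sym2 V → ℤ) {v x : V} (hx : x ≠ v) (δ : V → ℤ) :
    G.intWeight (c + G.starWeight v δ) x =
      G.intWeight c x + if G.Adj v x then δ x else 0 := by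
  unfold intWeight
  simp only [Pi.add_apply, Finset.sum_add_distrib, add_right_inj]
  have h : ∀ u ∈ G.neighborFinset x, G.starWeight v δ s(x, u) = if u = v then δ x else 0 := by
    intro u hu
    split_ifs with huv
    · subst huv
      rw [Sym2.eq_swap, G.starWeight_of_adj ((G.mem_neighborFinset _ _).1 hu).symm]
    · exact G.starWeight_of_ne hx huv δ
  rw [Finset.sum_congr rfl h, Finset.sum_ite_eq']
  simp only [mem_neighborFinset, G.adj_comm x v]

end Bump

/-- If each weight of `B` is `a u` or `a u + K`, then it can be changed by `0` or `±K` within these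
two values in such a way that the total change takes `#B + 1` values in arithmetic progression. -/
theorem exists_shift_within_pairs {V : Type*} [DecidableEq V] (B : Finset V) (w a : V → ℤ)
    (K : ℕ) (hw : ∀ u ∈ B, w u = a u ∨ w u = a u + K) :
    ∃ h : ℕ, ∀ j ≤ B.card, ∃ δ : V → ℤ, (∀ u ∉ B, δ u = 0) ∧ (∀ u, -K ≤ δ u ∧ δ u ≤ K) ∧
      (∀ u ∈ B, w u + δ u = a u ∨ w u + δ u = a u + K) ∧
      ∑ u ∈ B, δ u = (K : ℤ) * j - K * h := by
  -- h counts the vertices now at their upper value, j those that are to be there afterwards.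
  refine ⟨(B.filter fun u => w u ≠ a u).card, fun j hj => ?_⟩
  obtain ⟨T, hTB, hT⟩ := Finset.exists_subset_card_eq hj
  refine ⟨fun u => if u ∈ B then (K : ℤ) * ((if u ∈ T then 1 else 0) - if w u ≠ a u then 1 else 0)
    else 0, fun u hu => if_neg hu, fun u => ?_, fun u hu => ?_, ?_⟩
  · dsimp only
    split_ifs <;> constructor <;> simp
  · dsimp only
    rw [if_pos hu]
    by_cases h1 : w u = a u <;> by_cases h2 : u ∈ T <;> simp [h1, h2] <;>
      rcases hw u hu with h | h <;> first | exact absurd h h1 | (rw [h]; try simp)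
  · rw [Finset.sum_congr rfl fun u hu => if_pos hu, ← Finset.mul_sum, Finset.sum_sub_distrib,
      Finset.sum_boole, Finset.sum_boole, Finset.filter_mem_eq_inter, Finset.inter_eq_right.2 hTB,
      hT, mul_sub]

/-- Each member of the list has few related members after it whose weight is congruent to its own
modulo `K`. -/
def IsSpreadList {V : Type*} [DecidableEq V] (R : V → V → Prop) [DecidableRel R] (X : V → ℕ)
    (K : ℕ) (g : V → ℤ) : List V → Prop
  | [] => True
  -- The head is the member finalised last. The extra 1 allows for a partner finalised in the same
  -- step.
  | p :: l => p ∉ l ∧ (l.toFinset.filter fun u => R p u ∧ (K : ℤ) ∣ g u - g p).card ≤ X p + 1 ∧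
      IsSpreadList R X K g l

section Spread

variable {V : Type*} [DecidableEq V] {R : V → V → Prop} [DecidableRel R] {X : V → ℕ} {K : ℕ}

theorem IsSpreadList.congr {g g' : V → ℤ} {l : List V} (h : IsSpreadList R X K g l)
    (hg : ∀ u ∈ l, (K : ℤ) ∣ g' u - g u) : IsSpreadList R X K g' l := by
  induction l with
  | nil => trivial
  | cons p l ih =>
    obtain ⟨h1, h2, h3⟩ := h
    refine ⟨h1, ?_, ih h3 fun u hu => hg u (List.mem_cons_of_mem _ hu)⟩
    convert h2 using 2
    refine Finset.filter_congr fun u hu => and_congr_right fun _ => ?_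
    have h4 := hg u (List.mem_cons_of_mem _ (List.mem_toFinset.1 hu))
    have h5 := hg p List.mem_cons_self
    constructor
    · intro h
      have := (h.sub h4).add h5
      rwa [show g' u - g' p - (g' u - g u) + (g' p - g p) = g u - g p by ring] at this
    · intro h
      have := (h.add h4).sub h5
      rwa [show g u - g p + (g' u - g u) - (g' p - g p) = g' u - g' p by ring] at this

/-- Few small shifts of the weight of `p` create many congruences with related members. -/
theorem card_filter_shift_le (S : Finset V) (μ : ℕ) (hK : 4 * μ < K) (g : V → ℤ) (p : V)
    (hS : (S.filter fun u => R p u).card < (μ + 1) * (X p + 1)) (l : List V)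
    (hl : ∀ u ∈ l, u ∈ S) :
    ((Finset.Icc (0 : ℤ) (4 * μ)).filter fun x =>
      X p < (l.toFinset.filter fun u => R p u ∧ (K : ℤ) ∣ g u - (g p + x)).card).card ≤ μ := by
  set bad := (Finset.Icc (0 : ℤ) (4 * μ)).filter fun x =>
      X p < (l.toFinset.filter fun u => R p u ∧ (K : ℤ) ∣ g u - (g p + x)).card with hbad
  by_contra hcon
  push Not at hcon
  -- Shifts in [0, 4μ] are distinct modulo K, so they create congruences with disjoint sets of
  -- members. Each bad shift uses up at least X p + 1 of fewer than (μ + 1)(X p + 1) related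
  -- members.
  have hdisj : (bad : Set ℤ).PairwiseDisjoint
      fun x => l.toFinset.filter fun u => R p u ∧ (K : ℤ) ∣ g u - (g p + x) := by
    intro x hx y hy hxy
    rw [Function.onFun, Finset.disjoint_left]
    intro u hu hu'
    have h1 := (Finset.mem_filter.1 hu).2.2
    have h2 := (Finset.mem_filter.1 hu').2.2
    have h3 := h1.sub h2
    rw [show g u - (g p + x) - (g u - (g p + y)) = y - x by ring] at h3
    have hx' := Finset.mem_Icc.1 (Finset.mem_filter.1 hx).1
    have hy' := Finset.mem_Icc.1 (Finset.mem_filter.1 hy).1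
    have := Int.eq_zero_of_abs_lt_dvd h3 (by rw [abs_lt]; constructor <;> omega)
    omega
  have h1 : (bad.biUnion fun x => l.toFinset.filter fun u => R p u ∧
      (K : ℤ) ∣ g u - (g p + x)).card ≤ (S.filter fun u => R p u).card := by
    refine Finset.card_le_card fun u hu => ?_
    obtain ⟨x, -, hu⟩ := Finset.mem_biUnion.1 hu
    obtain ⟨hu, hR, -⟩ := Finset.mem_filter.1 hu
    exact Finset.mem_filter.2 ⟨hl u (List.mem_toFinset.1 hu), hR⟩
  rw [Finset.card_biUnion hdisj] at h1
  have h2 : bad.card * (X p + 1) ≤ ∑ x ∈ bad,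
      (l.toFinset.filter fun u => R p u ∧ (K : ℤ) ∣ g u - (g p + x)).card := by
    rw [← smul_eq_mul]
    exact Finset.card_nsmul_le_sum _ _ _ fun x hx => (Finset.mem_filter.1 hx).2
  have h3 : (μ + 1) * (X p + 1) ≤ bad.card * (X p + 1) := Nat.mul_le_mul_right _ hcon
  omega

/-- The weight of p is changed while p is still outside the list, so the conditions on the earlier
members are untouched. -/
theorem IsSpreadList.extend {g : V → ℤ} {l : List V} (h : IsSpreadList R X K g l) {p : V}
    (hp : p ∉ l) {x : ℤ}
    (hx : (l.toFinset.filter fun u => R p u ∧ (K : ℤ) ∣ g u - (g p + x)).card ≤ X p + 1)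
    (last : V → Prop) [DecidablePred last] :
    IsSpreadList R X K (g + Pi.single p x) (if last p then p :: l else l) := by
  have hne : ∀ u ∈ l, (g + Pi.single p x : V → ℤ) u = g u := by
    intro u hu
    rw [Pi.add_apply, Pi.single_eq_of_ne (ne_of_mem_of_not_mem hu hp), add_zero]
  have h1 : IsSpreadList R X K (g + Pi.single p x) l :=
    h.congr fun u hu => by rw [hne u hu, sub_self]; exact dvd_zero _
  split_ifs
  · refine ⟨hp, ?_, h1⟩
    refine (Finset.card_le_card ?_).trans hx
    intro u hu
    obtain ⟨hu, hR, hd⟩ := Finset.mem_filter.1 hu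
    rw [hne u (List.mem_toFinset.1 hu), Pi.add_apply, Pi.single_eq_same] at hd
    exact Finset.mem_filter.2 ⟨hu, hR, hd⟩
  · exact h1

/-- Small shifts with a prescribed sum, such that the list of the members that are already final
stays spread. -/
theorem exists_shift_isSpreadList (S : Finset V) (μ : ℕ) (hK : 4 * μ < K)
    (hS : ∀ p ∈ S, (S.filter fun u => R p u).card < (μ + 1) * (X p + 1))
    (last : V → Prop) (ps : List V) (hps : ps.Nodup) (hlen : 2 ≤ ps.length)
    (hpsS : ∀ p ∈ ps, p ∈ S) (g : V → ℤ) (l : List V) (hl : ∀ u ∈ l, u ∈ S)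
    (hpl : ∀ p ∈ ps, p ∉ l) (hg : IsSpreadList R X K g l) (t : ℤ)
    (ht : (μ : ℤ) * ps.length ≤ t) (ht' : t ≤ 3 * μ * ps.length) :
    ∃ f : V → ℤ, (∀ p, 0 ≤ f p ∧ f p ≤ 4 * μ) ∧ (∀ p ∉ ps, f p = 0) ∧ (ps.map f).sum = t ∧
      ∃ l' : List V, (∀ u, u ∈ l' ↔ u ∈ l ∨ (u ∈ ps ∧ last u)) ∧
        IsSpreadList R X K (g + f) l' := by
  classical
  induction ps generalizing g l t with
  | nil => simp at hlen
  | cons p ps ih =>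
    have hp := hpl p List.mem_cons_self
    have hbadp := card_filter_shift_le S μ hK g p (hS p (hpsS p List.mem_cons_self)) l hl
    set badp := (Finset.Icc (0 : ℤ) (4 * μ)).filter fun x =>
      X p < (l.toFinset.filter fun u => R p u ∧ (K : ℤ) ∣ g u - (g p + x)).card with hbadp_def
    have hgoodp : ∀ x ∈ Finset.Icc (0 : ℤ) (4 * μ), x ∉ badp →
        (l.toFinset.filter fun u => R p u ∧ (K : ℤ) ∣ g u - (g p + x)).card ≤ X p := by
      intro x hx hxb
      by_contra h
      exact hxb (Finset.mem_filter.2 ⟨hx, not_le.1 h⟩)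
    have hpps : p ∉ ps := (List.nodup_cons.1 hps).1
    have hnd : ps.Nodup := (List.nodup_cons.1 hps).2
    rcases ps with _ | ⟨p', ps⟩
    · simp at hlen
    rcases ps with _ | ⟨p'', ps⟩
    -- The last two shifts are chosen together, since the sum t ties them. At least 2μ + 1 values x
    -- are in range; at most μ are bad for p, and for at most μ the complement t - x is bad for p'.
    · have hp' := hpl p' (by simp)
      have hpp' : p' ≠ p := fun e => hpps (by simp [e])
      have hbadp' := card_filter_shift_le S μ hK g p' (hS p' (hpsS p' (by simp))) l hl
      set badp' := (Finset.Icc (0 : ℤ) (4 * μ)).filter fun x =>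
        X p' < (l.toFinset.filter fun u => R p' u ∧ (K : ℤ) ∣ g u - (g p' + x)).card
        with hbadp'_def
      simp only [List.length_cons, List.length_nil] at ht ht'
      push_cast at ht ht'
      have hcard : (badp ∪ badp'.image fun x => t - x).card <
          (Finset.Icc (max 0 (t - 4 * μ)) (min (4 * μ) t)).card := by
        have h1 := (Finset.card_union_le badp (badp'.image fun x => t - x)).trans
          (Nat.add_le_add hbadp (Finset.card_image_le.trans hbadp'))
        rw [Int.card_Icc]
        omega
      obtain ⟨x, hx, hxb⟩ := Finset.exists_mem_notMem_of_card_lt_card hcard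
      rw [Finset.mem_Icc, max_le_iff, le_min_iff] at hx
      rw [Finset.mem_union, not_or] at hxb
      have hx1 : x ∈ Finset.Icc (0 : ℤ) (4 * μ) := Finset.mem_Icc.2 ⟨hx.1.1, hx.2.1⟩
      have hx2 : t - x ∈ Finset.Icc (0 : ℤ) (4 * μ) := Finset.mem_Icc.2 ⟨by omega, by omega⟩
      have hxb2 : t - x ∉ badp' := fun h =>
        hxb.2 (Finset.mem_image.2 ⟨t - x, h, by ring⟩)
      have hc1 := hgoodp x hx1 hxb.1
      have hc2 : (l.toFinset.filter fun u => R p' u ∧ (K : ℤ) ∣ g u - (g p' + (t - x))).card ≤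
          X p' := by
        by_contra h
        exact hxb2 (Finset.mem_filter.2 ⟨hx2, not_le.1 h⟩)
      have hs1 := hg.extend hp (hc1.trans (Nat.le_succ _)) last
      set l1 := if last p then p :: l else l with hl1
      have hl1mem : ∀ u, u ∈ l1 ↔ u ∈ l ∨ (u = p ∧ last p) := by
        intro u
        rw [hl1]
        split_ifs with h
        · simp [h, or_comm]
        · simp [h]
      have hp'l1 : p' ∉ l1 := by
        rw [hl1mem]
        rintro (h | ⟨h, -⟩)
        · exact hp' h
        · exact hpp' h
      -- The badness of t - x was tested against l, but p may have joined the list since: this is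
      -- the extra 1.
      have hs2 := hs1.extend hp'l1 (x := t - x) (by
        refine (Finset.card_le_card (t := insert p (l.toFinset.filter fun u => R p' u ∧
          (K : ℤ) ∣ g u - (g p' + (t - x)))) fun u hu => ?_).trans
            ((Finset.card_insert_le _ _).trans (Nat.succ_le_succ hc2))
        obtain ⟨hu, hR, hd⟩ := Finset.mem_filter.1 hu
        rw [List.mem_toFinset, hl1mem] at hu
        rw [Finset.mem_insert]
        by_cases hup : u = p
        · exact Or.inl hup
        · right
          rw [Pi.add_apply, Pi.single_eq_of_ne hup, add_zero, Pi.add_apply,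
            Pi.single_eq_of_ne hpp', add_zero] at hd
          rw [Finset.mem_filter, List.mem_toFinset]
          exact ⟨hu.resolve_right fun h => hup h.1, hR, hd⟩) last
      refine ⟨Pi.single p x + Pi.single p' (t - x), ?_, ?_, ?_,
        (if last p' then p' :: l1 else l1), ?_, ?_⟩
      rotate_left 4
      · rw [← add_assoc]
        exact hs2
      · rw [Finset.mem_Icc] at hx1 hx2
        intro u
        rw [Pi.add_apply]
        by_cases h1 : u = p
        · subst h1
          rw [Pi.single_eq_same, Pi.single_eq_of_ne hpp'.symm]
          omega
        · by_cases h2 : u = p'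
          · subst h2
            rw [Pi.single_eq_same, Pi.single_eq_of_ne h1]
            omega
          · rw [Pi.single_eq_of_ne h1, Pi.single_eq_of_ne h2]
            omega
      · intro u hu
        simp only [List.mem_cons, List.not_mem_nil, or_false, not_or] at hu
        rw [Pi.add_apply, Pi.single_eq_of_ne hu.1, Pi.single_eq_of_ne hu.2, add_zero]
      · simp [Pi.single_eq_of_ne hpp', Pi.single_eq_of_ne hpp'.symm]
      · intro u
        split_ifs with h
        · rw [List.mem_cons, hl1mem]
          constructor
          · rintro (rfl | h' | ⟨rfl, h'⟩)
            · exact Or.inr ⟨by simp, h⟩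
            · exact Or.inl h'
            · exact Or.inr ⟨by simp, h'⟩
          · rintro (h' | ⟨h', h''⟩)
            · exact Or.inr (Or.inl h')
            · simp only [List.mem_cons, List.not_mem_nil, or_false] at h'
              rcases h' with rfl | rfl
              · exact Or.inr (Or.inr ⟨rfl, h''⟩)
              · exact Or.inl rfl
        · rw [hl1mem]
          constructor
          · rintro (h' | ⟨rfl, h'⟩)
            · exact Or.inl h'
            · exact Or.inr ⟨by simp, h'⟩
          · rintro (h' | ⟨h', h''⟩)
            · exact Or.inl h'
            · simp only [List.mem_cons, List.not_mem_nil, or_false] at h'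
              rcases h' with rfl | rfl
              · exact Or.inr ⟨rfl, h''⟩
              · exact absurd h'' h
    · have hlen' : 2 ≤ (p' :: p'' :: ps).length := by simp
      generalize p' :: p'' :: ps = ps' at *
      rw [List.length_cons] at ht ht'
      push_cast at ht ht'
      set n : ℤ := (ps'.length : ℤ) with hn
      have hn2 : 2 ≤ n := by rw [hn]; exact_mod_cast hlen'
      have hμn : 2 * (μ : ℤ) ≤ μ * n := by nlinarith [Int.natCast_nonneg μ]
      -- The window keeps t - x between μn and 3μn for the remaining n members; since n ≥ 2 it
      -- contains at least μ + 1 values.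
      have hcard : badp.card <
          (Finset.Icc (max 0 (t - 3 * μ * n)) (min (4 * μ) (t - μ * n))).card := by
        rw [Int.card_Icc]
        have e1 : (3 : ℤ) * μ * n = 3 * (μ * n) := by ring
        have e2 : (3 : ℤ) * μ * (n + 1) = 3 * (μ * n) + 3 * μ := by ring
        have e3 : (μ : ℤ) * (n + 1) = μ * n + μ := by ring
        rw [e2] at ht'
        rw [e3] at ht
        rw [e1]
        omega
      obtain ⟨x, hx, hxb⟩ := Finset.exists_mem_notMem_of_card_lt_card hcard
      rw [Finset.mem_Icc, max_le_iff, le_min_iff] at hx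
      have hx1 : x ∈ Finset.Icc (0 : ℤ) (4 * μ) := Finset.mem_Icc.2 ⟨hx.1.1, hx.2.1⟩
      have hc1 := hgoodp x hx1 hxb
      have hs1 := hg.extend hp (hc1.trans (Nat.le_succ _)) last
      set l1 := if last p then p :: l else l with hl1
      have hl1mem : ∀ u, u ∈ l1 ↔ u ∈ l ∨ (u = p ∧ last p) := by
        intro u
        rw [hl1]
        split_ifs with h
        · simp [h, or_comm]
        · simp [h]
      obtain ⟨f, hf1, hf2, hf3, l', hl'1, hl'2⟩ := ih hnd hlen'
        (fun q hq => hpsS q (List.mem_cons_of_mem _ hq)) (g + Pi.single p x) l1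
        (by
          intro u hu
          rcases (hl1mem u).1 hu with h | ⟨rfl, -⟩
          · exact hl u h
          · exact hpsS u List.mem_cons_self)
        (by
          intro q hq h
          rcases (hl1mem q).1 h with h | ⟨rfl, -⟩
          · exact hpl q (List.mem_cons_of_mem _ hq) h
          · exact hpps hq) hs1 (t - x) (by linarith [hx.2.2]) (by linarith [hx.1.2])
      refine ⟨Pi.single p x + f, ?_, ?_, ?_, l', ?_, ?_⟩
      · rw [Finset.mem_Icc] at hx1
        intro u
        rw [Pi.add_apply]
        by_cases h1 : u = p
        · subst h1
          rw [Pi.single_eq_same, hf2 u hpps]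
          omega
        · rw [Pi.single_eq_of_ne h1]
          have := hf1 u
          omega
      · intro u hu
        rw [List.mem_cons, not_or] at hu
        rw [Pi.add_apply, Pi.single_eq_of_ne hu.1, hf2 u hu.2, add_zero]
      · rw [List.map_cons, List.sum_cons, Pi.add_apply, Pi.single_eq_same, hf2 p hpps]
        have : ps'.map (Pi.single p x + f) = ps'.map f := by
          refine List.map_congr_left fun u hu => ?_
          rw [Pi.add_apply, Pi.single_eq_of_ne (ne_of_mem_of_not_mem hu hpps), zero_add]
        rw [this, hf3]
        ring
      · intro u
        rw [hl'1, hl1mem, List.mem_cons]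
        constructor
        · rintro ((h | ⟨rfl, h⟩) | ⟨h, h'⟩)
          · exact Or.inl h
          · exact Or.inr ⟨Or.inl rfl, h⟩
          · exact Or.inr ⟨Or.inr h, h'⟩
        · rintro (h | ⟨rfl | h, h'⟩)
          · exact Or.inl (Or.inl h)
          · exact Or.inl (Or.inr ⟨rfl, h'⟩)
          · exact Or.inr ⟨h, h'⟩
      · rw [← add_assoc]
        exact hl'2

end Spread

/-- An interval contains, outside a small set, an integer in the lower half of a block of length
`2 * K` whose number is not divisible by `q`. -/
theorem exists_lower_half_not_dvd (K q Y : ℕ) (hK : 0 < K) (hq : 0 < q) (F : Finset ℤ)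
    (hF : F.card < Y * (q - 1) * K) (s : ℤ) :
    ∃ z, z ∉ F ∧ s ≤ z ∧ z < s + 2 * K * q * (Y + 1) ∧ ¬ (q : ℤ) ∣ z / (2 * K) ∧
      z % (2 * K) < K := by
  classical
  set m : ℤ := 2 * K * q with hm
  have hm0 : 0 < m := by positivity
  -- Moving up to the start of a period of q blocks wastes at most one period, hence Y + 1 in the
  -- length.
  set s1 : ℤ := m * (s / m + 1) with hs1
  have h1 : s ≤ s1 := by
    have := Int.lt_mul_ediv_self_add (x := s) hm0
    rw [hs1, mul_add, mul_one]
    omega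
  have h2 : s1 ≤ s + m := by
    have := Int.mul_ediv_self_le (x := s) hm0.ne'
    rw [hs1, mul_add, mul_one]
    omega
  -- A candidate is given by a period, a block in it other than the first, and an offset in the
  -- lower half.
  set enc : ℕ × ℕ × ℕ → ℤ := fun x => s1 + (2 * K * (q * x.1 + x.2.1) + x.2.2 : ℕ) with henc
  set C : Finset (ℕ × ℕ × ℕ) := Finset.range Y ×ˢ Finset.Ico 1 q ×ˢ Finset.range K with hC
  have hmem : ∀ x ∈ C, x.1 < Y ∧ 1 ≤ x.2.1 ∧ x.2.1 < q ∧ x.2.2 < K := by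
    intro x hx
    simp only [hC, Finset.mem_product, Finset.mem_range, Finset.mem_Ico] at hx
    exact ⟨hx.1, hx.2.1.1, hx.2.1.2, hx.2.2⟩
  have hinj : Set.InjOn enc C := by
    intro x hx y hy hxy
    obtain ⟨-, -, hx2, hx3⟩ := hmem x hx
    obtain ⟨-, -, hy2, hy3⟩ := hmem y hy
    have h3 : 2 * K * (q * x.1 + x.2.1) + x.2.2 = 2 * K * (q * y.1 + y.2.1) + y.2.2 := by
      have := add_left_cancel hxy
      exact_mod_cast this
    have h4 : q * x.1 + x.2.1 = q * y.1 + y.2.1 := by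
      have := congrArg (· / (2 * K)) h3
      simpa [Nat.mul_add_div (by omega : 2 * K > 0), Nat.div_eq_of_lt (by omega : x.2.2 < 2 * K),
        Nat.div_eq_of_lt (by omega : y.2.2 < 2 * K)] using this
    have h5 : x.2.2 = y.2.2 := by
      rw [h4] at h3
      omega
    have h6 : x.1 = y.1 := by
      have := congrArg (· / q) h4
      simpa [Nat.mul_add_div hq, Nat.div_eq_of_lt hx2, Nat.div_eq_of_lt hy2] using this
    have h7 : x.2.1 = y.2.1 := by
      rw [h6] at h4
      omega
    exact Prod.ext h6 (Prod.ext h7 h5)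
  have hcard : F.card < (C.image enc).card := by
    rw [Finset.card_image_of_injOn hinj]
    simp only [hC, Finset.card_product, Finset.card_range, Nat.card_Ico]
    rw [← mul_assoc]
    exact hF
  obtain ⟨z, hz, hzF⟩ := Finset.exists_mem_notMem_of_card_lt_card hcard
  obtain ⟨x, hx, rfl⟩ := Finset.mem_image.1 hz
  obtain ⟨hx0, hx1, hx2, hx3⟩ := hmem x hx
  have hK2 : (0 : ℤ) < 2 * K := by positivity
  have hx3' : (x.2.2 : ℤ) < 2 * K := by omega
  have e : enc x = 2 * K * (q * (s / m + 1) + (q * x.1 + x.2.1)) + x.2.2 := by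
    simp only [henc, hs1, hm]
    push_cast
    ring
  have hdiv : enc x / (2 * K) = q * (s / m + 1) + (q * x.1 + x.2.1) := by
    rw [e, Int.mul_add_ediv_left _ _ hK2.ne',
      Int.ediv_eq_zero_of_lt (Int.natCast_nonneg x.2.2) hx3', add_zero]
  have hmod : enc x % (2 * K) = x.2.2 := by
    rw [e, Int.mul_add_emod_self_left, Int.emod_eq_of_lt (Int.natCast_nonneg x.2.2) hx3']
  refine ⟨enc x, hzF, ?_, ?_, ?_, ?_⟩
  · simp only [henc]
    have : (0 : ℤ) ≤ ((2 * K * (q * x.1 + x.2.1) + x.2.2 : ℕ) : ℤ) := Int.natCast_nonneg _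
    omega
  · have h3 : 2 * K * (q * x.1 + x.2.1) + x.2.2 < 2 * K * q * Y := by
      have h4 : q * x.1 + x.2.1 + 1 ≤ q * Y := by nlinarith
      nlinarith
    have h3' : ((2 * K * (q * x.1 + x.2.1) + x.2.2 : ℕ) : ℤ) < 2 * K * q * Y := by
      exact_mod_cast h3
    have h5 : (2 * K * q * (Y + 1) : ℤ) = 2 * K * q * Y + m := by rw [hm]; ring
    rw [h5]
    exact (add_lt_add_of_le_of_lt h2 h3').trans_eq (by ring)
  · rw [hdiv]
    intro h
    have h3 : (q : ℤ) ∣ x.2.1 := by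
      rw [show (q : ℤ) * (s / m + 1) + (q * x.1 + x.2.1) =
        q * (s / m + 1 + x.1) + x.2.1 by ring] at h
      exact (Int.dvd_add_right (dvd_mul_right _ _)).1 h
    have := Nat.le_of_dvd (by omega) (Int.natCast_dvd_natCast.1 h3)
    omega
  · rw [hmod]
    exact_mod_cast hx3

/-- An arithmetic progression of difference `K` contains, outside a small set, a term in a block of
length `2 * K` whose number is divisible by `q`. -/
theorem exists_progression_dvd (K q Y n : ℕ) (hK : 0 < K) (hq : 0 < q) (hn : 2 * q * Y ≤ n)
    (F : Finset ℤ) (hF : F.card < Y) (s : ℤ) :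
    ∃ j ≤ n, s + K * j ∉ F ∧ (q : ℤ) ∣ (s + K * j) / (2 * K) := by
  classical
  have hK2 : (0 : ℤ) < 2 * K := by positivity
  have hq' : (0 : ℤ) < q := by exact_mod_cast hq
  -- The number of blocks from s to the next one divisible by q. Two steps of length K make one
  -- block, so the terms with index 2(i + qy) all qualify.
  set i : ℕ := ((-(s / (2 * K))) % q).toNat with hi
  have hi0 := Int.emod_nonneg (-(s / (2 * K))) hq'.ne'
  have hiq : i < q := by
    have := Int.emod_lt_of_pos (-(s / (2 * K))) hq'
    omega
  have hdvd : (q : ℤ) ∣ s / (2 * K) + i := by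
    rw [hi, Int.toNat_of_nonneg hi0]
    have := Int.mul_ediv_add_emod (-(s / (2 * K))) q
    exact ⟨-(-(s / (2 * K)) / q), by linarith⟩
  set enc : ℕ → ℤ := fun y => s + K * (2 * (i + q * y) : ℕ) with henc
  have hinj : Set.InjOn enc (Finset.range Y) := by
    intro x _ y _ hxy
    have h1 := add_left_cancel hxy
    have h2 := Int.natCast_inj.1 (mul_left_cancel₀ (by exact_mod_cast hK.ne') h1)
    have h3 : q * x = q * y := by omega
    exact Nat.eq_of_mul_eq_mul_left hq h3
  have hcard : F.card < ((Finset.range Y).image enc).card := by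
    rw [Finset.card_image_of_injOn hinj, Finset.card_range]
    exact hF
  obtain ⟨z, hz, hzF⟩ := Finset.exists_mem_notMem_of_card_lt_card hcard
  obtain ⟨y, hy, rfl⟩ := Finset.mem_image.1 hz
  rw [Finset.mem_range] at hy
  refine ⟨2 * (i + q * y), ?_, hzF, ?_⟩
  · have : i + q * y ≤ q * Y := by nlinarith
    nlinarith
  · have e : s + K * ((2 * (i + q * y) : ℕ) : ℤ) = s + (2 * K) * (i + q * y) := by
      push_cast
      ring
    rw [e, Int.add_mul_ediv_left _ _ hK2.ne', ← add_assoc]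
    exact hdvd.add (dvd_mul_right _ _)

end SimpleGraph

/-! ### The weighting algorithm -/

namespace SimpleGraph

section Algorithm

variable {V : Type*} [Fintype V] (G : SimpleGraph V) [DecidableRel G.Adj]

open Classical in
/-- The numerical conditions on an ordered partition of the vertices, with the last part consisting
of the vertices `v` with `T ≤ col v`, under which the weighting algorithm below succeeds. -/
structure IsBalancedSplit (r : ℕ) (col : V → ℕ) (T K μ q : ℕ) (X : V → ℕ) : Prop where
  four_mul_lt : 4 * μ < K
  q_pos : 0 < q
  -- The bound on K lets the small increases on edges into the last part bridge a gap of length K. Y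
  -- counts the full periods inside the reachable interval; their admissible values must outnumber
  -- the r-neighbours possibly handled before.
  low : ∀ v, col v < T → 2 ≤ ((G.neighborFinset v).filter fun u => T ≤ col u).card ∧
    K ≤ 2 * μ * ((G.neighborFinset v).filter fun u => T ≤ col u).card + 1 ∧
    ∃ Y, 2 * K * q * (Y + 1) ≤ K * ((G.neighborFinset v).filter fun u => col u < col v).card +
        2 * μ * ((G.neighborFinset v).filter fun u => T ≤ col u).card + 1 ∧
      (Finset.univ.filter fun u => G.IsDistantNeighbor r v u ∧ col u ≤ col v).card <
        Y * (q - 1) * K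
  -- At most μ of the 4μ + 1 small shifts at p are then bad.
  high : ∀ p, T ≤ col p →
    ((Finset.univ.filter fun u => T ≤ col u).filter fun u => G.IsDistantNeighbor r p u).card <
      (μ + 1) * (X p + 1)
  -- Toggling the neighbours outside the last part reaches Y weights in blocks reserved for p, more
  -- than there are congruent weights to avoid.
  high' : ∀ p, T ≤ col p → ∃ Y, X p + 1 < Y ∧
    2 * q * Y ≤ ((G.neighborFinset p).filter fun u => col u < T).card

open Classical in
/-- The state of the first phase of the algorithm after processing the vertices in `Q`. -/
structure IsPartialWeighting (r : ℕ) (col : V → ℕ) (T K μ q : ℕ) (X : V → ℕ) (Q : Finset V)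
    (c : Sym2 V → ℤ) (a : V → ℤ) (l : List V) : Prop where
  lt_of_mem : ∀ v ∈ Q, col v < T
  untouched : ∀ x, col x < T → x ∉ Q → ∀ y, G.Adj x y → c s(x, y) = K + 1
  low : ∀ x y, G.Adj x y → col x < T → col y < T → 1 ≤ c s(x, y) ∧ c s(x, y) ≤ 2 * K + 1
  mixed : ∀ x y, G.Adj x y → col x < T → T ≤ col y →
    K + 1 ≤ c s(x, y) ∧ c s(x, y) ≤ K + 1 + 4 * μ
  high : ∀ x y, G.Adj x y → T ≤ col x → T ≤ col y → c s(x, y) = K + 1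
  weight : ∀ v ∈ Q, G.intWeight c v = a v ∨ G.intWeight c v = a v + K
  not_dvd : ∀ v ∈ Q, ¬ (q : ℤ) ∣ a v / (2 * K) ∧ a v % (2 * K) < K
  ne : ∀ u ∈ Q, ∀ v ∈ Q, G.IsDistantNeighbor r u v → a u ≠ a v
  mem_list : ∀ p, p ∈ l ↔ T ≤ col p ∧ ∀ y, G.Adj p y → col y < T → y ∈ Q
  spread : IsSpreadList (G.IsDistantNeighbor r) X K (G.intWeight c) l

variable {G} {r : ℕ} {col : V → ℕ} {T K μ q : ℕ} {X : V → ℕ}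

/-- When v is handled, only its edges to handled neighbours (by at most K, within their pairs) and
into the last part (by at most 4μ, upwards) change. So in this phase every edge is altered at most
once, which yields the ranges in the invariant. -/
theorem IsPartialWeighting.exists_insert (H : G.IsBalancedSplit r col T K μ q X) {Q : Finset V}
    {c : Sym2 V → ℤ} {a : V → ℤ} {l : List V}
    (S : G.IsPartialWeighting r col T K μ q X Q c a l) {v : V} (hvQ : v ∉ Q) (hvT : col v < T)
    (hbefore : ∀ u, col u < col v → u ∈ Q) (hafter : ∀ u ∈ Q, col u ≤ col v) [DecidableEq V] :
    ∃ c' a' l', G.IsPartialWeighting r col T K μ q X (insert v Q) c' a' l' := by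
  classical
  obtain ⟨hn2, hKn, Y, hY1, hY2⟩ := H.low v hvT
  set P := (G.neighborFinset v).filter fun u => T ≤ col u with hP
  set n := P.card with hn
  have hK0 : 0 < K := by have := H.four_mul_lt; omega
  have hPmem : ∀ u, u ∈ P ↔ G.Adj v u ∧ T ≤ col u := by
    intro u
    rw [hP, Finset.mem_filter, mem_neighborFinset]
  set B := (G.neighborFinset v).filter fun u => u ∈ Q with hB
  have hBmem : ∀ u, u ∈ B ↔ G.Adj v u ∧ u ∈ Q := by
    intro u
    rw [hB, Finset.mem_filter, mem_neighborFinset]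
  have hBcard : ((G.neighborFinset v).filter fun u => col u < col v).card ≤ B.card := by
    refine Finset.card_le_card fun u hu => ?_
    obtain ⟨h1, h2⟩ := Finset.mem_filter.1 hu
    exact Finset.mem_filter.2 ⟨h1, hbefore u h2⟩
  obtain ⟨h, hh⟩ := exists_shift_within_pairs B (G.intWeight c) a K
    fun u hu => S.weight u ((hBmem u).1 hu).2
  obtain ⟨z, hzF, hz1, hz2, hz3, hz4⟩ := exists_lower_half_not_dvd K q Y hK0 H.q_pos
    ((Q.filter fun u => G.IsDistantNeighbor r v u).image a)
    (by
      refine (Finset.card_image_le.trans (Finset.card_le_card ?_)).trans_lt hY2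
      intro u hu
      obtain ⟨h1, h2⟩ := Finset.mem_filter.1 hu
      exact Finset.mem_filter.2 ⟨Finset.mem_univ _, h2, hafter u h1⟩)
    (G.intWeight c v - K * h + μ * n)
  -- Division by K: the quotient, capped at the size of B, is left to the toggles and the rest to
  -- the small increases, which have 2μn ≥ K - 1 of room.
  obtain ⟨j, hj, t, ht1, ht2, hzjt⟩ : ∃ j ≤ B.card, ∃ t : ℤ, (μ : ℤ) * n ≤ t ∧ t ≤ 3 * μ * n ∧
      z = G.intWeight c v - K * h + K * j + t := by
    set w := z - (G.intWeight c v - K * h + μ * n) with hw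
    have hw0 : 0 ≤ w := by omega
    have hKB : (K : ℤ) * ((G.neighborFinset v).filter fun u => col u < col v).card ≤
        K * B.card := by
      exact_mod_cast Nat.mul_le_mul_left K hBcard
    have hw1 : w ≤ K * B.card + 2 * μ * n := by
      have h1 : (2 * K * q * (Y + 1) : ℤ) ≤
          K * ((G.neighborFinset v).filter fun u => col u < col v).card + 2 * μ * n + 1 := by
        exact_mod_cast hY1
      linarith
    have hKn' : (K : ℤ) ≤ 2 * μ * n + 1 := by exact_mod_cast hKn
    have e3 : (3 : ℤ) * μ * n = μ * n + 2 * μ * n := by ring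
    by_cases hcase : w / K ≤ B.card
    · have h0 : 0 ≤ w / K := Int.ediv_nonneg hw0 (by positivity)
      refine ⟨(w / K).toNat, by omega, w % K + μ * n, ?_, ?_, ?_⟩
      · have := Int.emod_nonneg w (show (K : ℤ) ≠ 0 by omega)
        linarith
      · have := Int.emod_lt_of_pos w (show (0 : ℤ) < K by omega)
        rw [e3]
        linarith
      · rw [Int.toNat_of_nonneg h0]
        have := Int.mul_ediv_add_emod w K
        linarith
    · push Not at hcase
      refine ⟨B.card, le_rfl, w - K * B.card + μ * n, ?_, ?_, ?_⟩
      · have h1 : (K : ℤ) * B.card ≤ K * (w / K) := by gcongr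
        have := Int.mul_ediv_self_le (x := w) (k := (K : ℤ)) (by omega)
        linarith
      · rw [e3]
        linarith
      · linarith
  obtain ⟨δ, hδ1, hδ2, hδ3, hδ4⟩ := hh j hj
  obtain ⟨f, hf1, hf2, hf3, l', hl'1, hl'2⟩ := exists_shift_isSpreadList
    (R := G.IsDistantNeighbor r) (X := X) (K := K)
    (Finset.univ.filter fun u => T ≤ col u) μ H.four_mul_lt
    (fun p hp => by convert H.high p (Finset.mem_filter.1 hp).2)
    -- A vertex of the last part is final modulo K once all its neighbours outside that part have
    -- been handled.
    (fun p => ∀ y, G.Adj p y → col y < T → y ∈ insert v Q) P.toList P.nodup_toList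
    (by rw [Finset.length_toList]; exact hn2)
    (fun p hp => Finset.mem_filter.2
      ⟨Finset.mem_univ _, ((hPmem p).1 (Finset.mem_toList.1 hp)).2⟩)
    (G.intWeight c) l
    (fun u hu => Finset.mem_filter.2 ⟨Finset.mem_univ _, ((S.mem_list u).1 hu).1⟩)
    (fun p hp hpl => hvQ (((S.mem_list p).1 hpl).2 v
      ((hPmem p).1 (Finset.mem_toList.1 hp)).1.symm hvT))
    (by convert S.spread) t (by rw [Finset.length_toList]; exact ht1)
    (by rw [Finset.length_toList]; exact ht2)
  simp only [Finset.mem_toList] at hf2 hl'1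
  rw [Finset.sum_map_toList] at hf3
  set c' := c + G.starWeight v (δ + f) with hc'
  have hf0 : ∀ u, col u < T → f u = 0 := fun u hu => hf2 u fun h => by
    have := ((hPmem u).1 h).2
    omega
  have hδ0 : ∀ u, u ∉ Q → δ u = 0 := fun u hu => hδ1 u fun h => hu ((hBmem u).1 h).2
  have hQlow : ∀ u, T ≤ col u → u ∉ Q := fun u hu h => by
    have := S.lt_of_mem u h
    omega
  have hc'v : ∀ y, G.Adj v y → c' s(v, y) = K + 1 + (δ y + f y) := by
    intro y hy
    rw [hc', Pi.add_apply, G.starWeight_of_adj hy, S.untouched v hvT hvQ y hy, Pi.add_apply]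
  have hc'ne : ∀ x y, x ≠ v → y ≠ v → c' s(x, y) = c s(x, y) := by
    intro x y hx hy
    rw [hc', Pi.add_apply, G.starWeight_of_ne hx hy, add_zero]
  have hwv : G.intWeight c' v = z := by
    rw [hc', G.intWeight_add_starWeight_self]
    simp only [Pi.add_apply, Finset.sum_add_distrib]
    have e1 : ∑ u ∈ G.neighborFinset v, δ u = ∑ u ∈ B, δ u :=
      (Finset.sum_subset (Finset.filter_subset _ _) fun u _ hu => hδ1 u hu).symm
    have e2 : ∑ u ∈ G.neighborFinset v, f u = ∑ u ∈ P, f u :=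
      (Finset.sum_subset (Finset.filter_subset _ _) fun u _ hu => hf2 u hu).symm
    rw [e1, e2, hδ4, hf3, hzjt]
    ring
  have hwne : ∀ u, u ≠ v → G.intWeight c' u =
      G.intWeight c u + if G.Adj v u then δ u + f u else 0 := by
    intro u hu
    rw [hc', G.intWeight_add_starWeight_of_ne c hu, Pi.add_apply]
  refine ⟨c', Function.update a v z, l', ?_, ?_, ?_, ?_, ?_, ?_, ?_, ?_, ?_, ?_⟩
  · intro u hu
    rcases Finset.mem_insert.1 hu with rfl | hu
    · exact hvT
    · exact S.lt_of_mem u hu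
  · intro x hx hxQ y hxy
    rw [Finset.mem_insert, not_or] at hxQ
    by_cases hyv : y = v
    · subst hyv
      rw [Sym2.eq_swap, hc'v x hxy.symm, hδ0 x hxQ.2, hf0 x hx]
      ring
    · rw [hc'ne x y hxQ.1 hyv, S.untouched x hx hxQ.2 y hxy]
  · intro x y hxy hx hy
    by_cases hxv : x = v
    · subst hxv
      rw [hc'v y hxy, hf0 y hy]
      have := hδ2 y
      constructor <;> linarith
    · by_cases hyv : y = v
      · subst hyv
        rw [Sym2.eq_swap, hc'v x hxy.symm, hf0 x hx]
        have := hδ2 x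
        constructor <;> linarith
      · rw [hc'ne x y hxv hyv]
        exact S.low x y hxy hx hy
  · intro x y hxy hx hy
    by_cases hxv : x = v
    · subst hxv
      rw [hc'v y hxy, hδ0 y (hQlow y hy)]
      have := hf1 y
      constructor <;> linarith
    · rw [hc'ne x y hxv (by rintro rfl; omega)]
      exact S.mixed x y hxy hx hy
  · intro x y hxy hx hy
    rw [hc'ne x y (by rintro rfl; omega) (by rintro rfl; omega)]
    exact S.high x y hxy hx hy
  · intro u hu
    by_cases huv : u = v
    · subst huv
      rw [Function.update_self, hwv]
      exact Or.inl rfl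
    · have huQ := (Finset.mem_insert.1 hu).resolve_left huv
      rw [Function.update_of_ne huv, hwne u huv]
      split_ifs with hadj
      · rw [hf0 u (S.lt_of_mem u huQ), add_zero]
        exact hδ3 u ((hBmem u).2 ⟨hadj, huQ⟩)
      · rw [add_zero]
        exact S.weight u huQ
  · intro u hu
    by_cases huv : u = v
    · subst huv
      rw [Function.update_self]
      exact ⟨hz3, hz4⟩
    · rw [Function.update_of_ne huv]
      exact S.not_dvd u ((Finset.mem_insert.1 hu).resolve_left huv)
  · have key : ∀ u ∈ Q, G.IsDistantNeighbor r v u → z ≠ a u := by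
      rintro u hu hvu rfl
      exact hzF (Finset.mem_image_of_mem _ (Finset.mem_filter.2 ⟨hu, hvu⟩))
    intro x hx y hy hxy
    by_cases hxv : x = v
    · subst hxv
      have hyx := hxy.1.symm
      rw [Function.update_self, Function.update_of_ne hyx]
      exact key y ((Finset.mem_insert.1 hy).resolve_left hyx) hxy
    · have hx' := (Finset.mem_insert.1 hx).resolve_left hxv
      rw [Function.update_of_ne hxv]
      by_cases hyv : y = v
      · subst hyv
        rw [Function.update_self]
        exact (key x hx' ((G.isDistantNeighbor_comm).1 hxy)).symm
      · rw [Function.update_of_ne hyv]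
        exact S.ne x hx' y ((Finset.mem_insert.1 hy).resolve_left hyv) hxy
  · intro p
    rw [hl'1, S.mem_list, hPmem]
    constructor
    · rintro (⟨h1, h2⟩ | ⟨⟨-, h1⟩, h2⟩)
      · exact ⟨h1, fun y hy hyT => Finset.mem_insert_of_mem (h2 y hy hyT)⟩
      · exact ⟨h1, h2⟩
    · rintro ⟨h1, h2⟩
      by_cases hadj : G.Adj v p
      · exact Or.inr ⟨⟨hadj, h1⟩, h2⟩
      · refine Or.inl ⟨h1, fun y hy hyT => (Finset.mem_insert.1 (h2 y hy hyT)).resolve_left ?_⟩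
        rintro rfl
        exact hadj hy.symm
  · have : IsSpreadList (G.IsDistantNeighbor r) X K (G.intWeight c') l' := by
      refine hl'2.congr fun p hp => ?_
      have hpT : T ≤ col p := by
        rcases (hl'1 p).1 hp with h | ⟨h, -⟩
        · exact ((S.mem_list p).1 h).1
        · exact ((hPmem p).1 h).2
      have hpv : p ≠ v := by rintro rfl; omega
      rw [hwne p hpv, Pi.add_apply, hδ0 p (hQlow p hpT), zero_add]
      split_ifs with hadj
      · simp
      · rw [hf2 p fun h => hadj ((hPmem p).1 h).1]
        simp
    convert this

theorem IsBalancedSplit.exists_isPartialWeighting (H : G.IsBalancedSplit r col T K μ q X)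
    [DecidableEq V] :
    ∃ c a l, G.IsPartialWeighting r col T K μ q X (Finset.univ.filter fun v => col v < T) c a l := by
  classical
  set A := Finset.univ.filter fun v => col v < T with hA
  suffices h : ∀ n ≤ A.card, ∃ Q ⊆ A, Q.card = n ∧ (∀ u ∈ Q, ∀ v ∈ A, v ∉ Q → col u ≤ col v) ∧
      ∃ c a l, G.IsPartialWeighting r col T K μ q X Q c a l by
    obtain ⟨Q, hQA, hQ, -, h⟩ := h A.card le_rfl
    rwa [← Finset.eq_of_subset_of_card_le hQA hQ.ge]
  intro n
  induction n with
  | zero =>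
    intro _
    refine ⟨∅, Finset.empty_subset _, rfl, by simp, fun _ => K + 1, fun _ => 0, [], ?_⟩
    refine ⟨by simp, fun _ _ _ _ _ => rfl, fun _ _ _ _ _ => ⟨by omega, by omega⟩,
      fun _ _ _ _ _ => ⟨by omega, by omega⟩, fun _ _ _ _ _ => rfl, by simp, by simp, by simp,
      fun p => ?_, trivial⟩
    -- Nothing is final at the start: by `high'` every vertex of the last part has a neighbour
    -- outside it.
    simp only [List.not_mem_nil, Finset.notMem_empty, imp_false, not_lt, false_iff, not_and]
    intro hp h
    obtain ⟨Y, hY1, hY2⟩ := H.high' p hp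
    have : ((G.neighborFinset p).filter fun u => col u < T) = ∅ := by
      refine Finset.filter_eq_empty_iff.2 fun u hu => not_lt.2 (h u ?_)
      exact (G.mem_neighborFinset _ _).1 hu
    rw [this, Finset.card_empty] at hY2
    have := Nat.mul_pos (Nat.mul_pos two_pos H.q_pos) (Nat.zero_lt_of_lt hY1)
    omega
  | succ n ih =>
    intro hn
    obtain ⟨Q, hQA, hQ, hQord, c, a, l, S⟩ := ih (by omega)
    have hne : (A \ Q).Nonempty := by
      rw [← Finset.card_pos, Finset.card_sdiff_of_subset hQA]
      omega
    obtain ⟨v, hv, hmin⟩ := Finset.exists_min_image (A \ Q) col hne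
    obtain ⟨hvA, hvQ⟩ := Finset.mem_sdiff.1 hv
    have hvT : col v < T := (Finset.mem_filter.1 hvA).2
    refine ⟨insert v Q, Finset.insert_subset hvA hQA, ?_, ?_,
      S.exists_insert H hvQ hvT ?_ fun u hu => hQord u hu v hvA hvQ⟩
    · rw [Finset.card_insert_of_notMem hvQ, hQ]
    · intro u hu w hw hwQ
      rw [Finset.mem_insert, not_or] at hwQ
      rcases Finset.mem_insert.1 hu with rfl | hu
      · exact hmin w (Finset.mem_sdiff.2 ⟨hw, hwQ.2⟩)
      · exact hQord u hu w hw hwQ.2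
    · intro u hu
      by_contra huQ
      have := hmin u (Finset.mem_sdiff.2
        ⟨Finset.mem_filter.2 ⟨Finset.mem_univ _, by omega⟩, huQ⟩)
      omega

/-- The second phase of the algorithm: the vertices of the last part are processed in the order in
which their weights became final modulo `K`. -/
theorem IsPartialWeighting.exists_adjust_list (H : G.IsBalancedSplit r col T K μ q X)
    {Q : Finset V} {c : Sym2 V → ℤ} {a : V → ℤ} {l : List V}
    (S : G.IsPartialWeighting r col T K μ q X Q c a l) (hQ : ∀ v, col v < T → v ∈ Q)
    [DecidableEq V] (m : List V) (hm : ∀ p ∈ m, T ≤ col p)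
    [DecidableRel (G.IsDistantNeighbor r)]
    (hspread : IsSpreadList (G.IsDistantNeighbor r) X K (G.intWeight c) m) :
    ∃ c' : Sym2 V → ℤ,
      (∀ v, col v < T → G.intWeight c' v = a v ∨ G.intWeight c' v = a v + K) ∧
      (∀ x y, G.Adj x y → x ∉ m → y ∉ m → c' s(x, y) = c s(x, y)) ∧
      (∀ x y, G.Adj x y → T ≤ col x → T ≤ col y → c' s(x, y) = c s(x, y)) ∧
      (∀ x y, G.Adj x y → col x < T → T ≤ col y →
        1 ≤ c' s(x, y) ∧ c' s(x, y) ≤ 2 * K + 1 + 4 * μ) ∧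
      (∀ p, T ≤ col p → (K : ℤ) ∣ G.intWeight c' p - G.intWeight c p) ∧
      (∀ p ∈ m, (q : ℤ) ∣ G.intWeight c' p / (2 * K)) ∧
      (∀ p ∈ m, ∀ p' ∈ m, G.IsDistantNeighbor r p p' → G.intWeight c' p ≠ G.intWeight c' p') := by
  have hK0 : 0 < K := by have := H.four_mul_lt; omega
  induction m with
  | nil =>
    refine ⟨c, fun v hv => S.weight v (hQ v hv), fun _ _ _ _ _ => rfl, fun _ _ _ _ _ => rfl, ?_,
      fun p _ => by simp, by simp, by simp⟩
    intro x y hxy hx hy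
    have := S.mixed x y hxy hx hy
    constructor <;> linarith
  | cons p m ih =>
    obtain ⟨hpm, hcard, hspread'⟩ := hspread
    have hpT := hm p List.mem_cons_self
    obtain ⟨c', h1, h2, h3, h4, h5, h6, h7⟩ := ih (fun p hp => hm p (List.mem_cons_of_mem _ hp))
      hspread'
    obtain ⟨Y, hY1, hY2⟩ := H.high' p hpT
    set B := (G.neighborFinset p).filter fun u => col u < T with hB
    have hBmem : ∀ u, u ∈ B ↔ G.Adj p u ∧ col u < T := by
      intro u
      rw [hB, Finset.mem_filter, mem_neighborFinset]
    obtain ⟨h, hh⟩ := exists_shift_within_pairs B (G.intWeight c') a K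
      fun u hu => h1 u ((hBmem u).1 hu).2
    -- Weights in the last part move only by multiples of K, so only members congruent to p after
    -- the first phase can collide with it.
    obtain ⟨j, hj, hjF, hjq⟩ := exists_progression_dvd K q Y B.card hK0 H.q_pos hY2
      ((m.toFinset.filter fun u => G.IsDistantNeighbor r p u ∧
        (K : ℤ) ∣ G.intWeight c u - G.intWeight c p).image (G.intWeight c'))
      ((Finset.card_image_le.trans hcard).trans_lt hY1) (G.intWeight c' p - K * h)
    obtain ⟨δ, hδ1, hδ2, hδ3, hδ4⟩ := hh j hj
    set d := c' + G.starWeight p δ with hd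
    have hδ0 : ∀ u, T ≤ col u → δ u = 0 := fun u hu => hδ1 u fun h => by
      have := ((hBmem u).1 h).2
      omega
    have hdp : ∀ y, G.Adj p y → d s(p, y) = c' s(p, y) + δ y := by
      intro y hy
      rw [hd, Pi.add_apply, G.starWeight_of_adj hy]
    have hdne : ∀ x y, x ≠ p → y ≠ p → d s(x, y) = c' s(x, y) := by
      intro x y hx hy
      rw [hd, Pi.add_apply, G.starWeight_of_ne hx hy, add_zero]
    have hwp : G.intWeight d p = G.intWeight c' p - K * h + K * j := by
      rw [hd, G.intWeight_add_starWeight_self]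
      have e1 : ∑ u ∈ G.neighborFinset p, δ u = ∑ u ∈ B, δ u :=
        (Finset.sum_subset (Finset.filter_subset _ _) fun u _ hu => hδ1 u hu).symm
      rw [e1, hδ4]
      ring
    have hwne : ∀ u, u ≠ p → G.intWeight d u = G.intWeight c' u + if G.Adj p u then δ u else 0 :=
      fun u hu => by rw [hd, G.intWeight_add_starWeight_of_ne c' hu]
    have hwhigh : ∀ u, u ≠ p → T ≤ col u → G.intWeight d u = G.intWeight c' u := by
      intro u hu huT
      rw [hwne u hu, hδ0 u huT, ite_self, add_zero]
    have hmT : ∀ u ∈ m, T ≤ col u := fun u hu => hm u (List.mem_cons_of_mem _ hu)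
    have hmp : ∀ u ∈ m, u ≠ p := fun u hu => ne_of_mem_of_not_mem hu hpm
    refine ⟨d, ?_, ?_, ?_, ?_, ?_, ?_, ?_⟩
    · intro v hv
      rw [hwne v (by rintro rfl; omega)]
      split_ifs with hadj
      · exact hδ3 v ((hBmem v).2 ⟨hadj, hv⟩)
      · rw [add_zero]
        exact h1 v hv
    · intro x y hxy hx hy
      rw [List.mem_cons, not_or] at hx hy
      rw [hdne x y hx.1 hy.1]
      exact h2 x y hxy hx.2 hy.2
    · intro x y hxy hx hy
      rw [← h3 x y hxy hx hy]
      by_cases hxp : x = p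
      · subst hxp
        rw [hdp y hxy, hδ0 y hy, add_zero]
      · by_cases hyp : y = p
        · subst hyp
          rw [Sym2.eq_swap, hdp x hxy.symm, hδ0 x hx, add_zero]
        · exact hdne x y hxp hyp
    · intro x y hxy hx hy
      by_cases hyp : y = p
      · subst hyp
        -- Neither end belongs to the tail, so this edge still has its value from the first phase
        -- and is changed by at most K only now.
        rw [Sym2.eq_swap, hdp x hxy.symm, Sym2.eq_swap, h2 x y hxy
          (fun hxm => by have := hmT x hxm; omega) hpm]
        have := S.mixed x y hxy hx hy
        have := hδ2 x
        constructor <;> linarith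
      · rw [hdne x y (by rintro rfl; omega) hyp]
        exact h4 x y hxy hx hy
    · intro u hu
      by_cases hup : u = p
      · subst hup
        rw [hwp]
        have e : G.intWeight c' u - K * h + K * j - G.intWeight c u =
          (G.intWeight c' u - G.intWeight c u) + K * (j - h) := by ring
        rw [e]
        exact (h5 u hu).add (dvd_mul_right _ _)
      · rw [hwhigh u hup hu]
        exact h5 u hu
    · intro u hu
      rcases List.mem_cons.1 hu with rfl | hu
      · rw [hwp]
        exact hjq
      · rw [hwhigh u (hmp u hu) (hmT u hu)]
        exact h6 u hu
    · have key : ∀ u ∈ m, G.IsDistantNeighbor r p u → G.intWeight d p ≠ G.intWeight d u := by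
        intro u hu hpu heq
        rw [hwp, hwhigh u (hmp u hu) (hmT u hu)] at heq
        refine hjF ?_
        rw [heq]
        refine Finset.mem_image_of_mem _ (Finset.mem_filter.2 ⟨List.mem_toFinset.2 hu, hpu, ?_⟩)
        have e1 := h5 u (hmT u hu)
        have e2 := h5 p hpT
        have e : G.intWeight c u - G.intWeight c p = (G.intWeight c' p - G.intWeight c p) -
          (G.intWeight c' u - G.intWeight c u) + K * (j - h) := by
          rw [← heq]
          ring
        rw [e]
        exact (e2.sub e1).add (dvd_mul_right _ _)
      intro u hu w hw huw
      rcases List.mem_cons.1 hu with rfl | hum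
      · rcases List.mem_cons.1 hw with rfl | hwm
        · exact absurd rfl huw.1
        · exact key w hwm huw
      · rcases List.mem_cons.1 hw with rfl | hwm
        · exact (key u hum ((G.isDistantNeighbor_comm).1 huw)).symm
        · rw [hwhigh u (hmp u hum) (hmT u hum), hwhigh w (hmp w hwm) (hmT w hwm)]
          exact h7 u hum w hwm huw

/-- Outside the last part, a v lies in the lower half of its block and a v + K in the upper half of
the same block, so distinct reserved values give disjoint pairs. Divisibility of the block number by
q separates the last part from the rest, and the second phase separates its members from each other.
-/
theorem IsBalancedSplit.exists_isDistantIrregularColoring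
    (H : G.IsBalancedSplit r col T K μ q X) :
    ∃ c : Sym2 V → ℕ, G.IsDistantIrregularColoring r (2 * K + 4 * μ + 1) c := by
  classical
  obtain ⟨c, a, l, S⟩ := H.exists_isPartialWeighting
  have hQ : ∀ v, col v < T → v ∈ Finset.univ.filter fun v => col v < T := fun v hv =>
    Finset.mem_filter.2 ⟨Finset.mem_univ _, hv⟩
  have hl : ∀ p, p ∈ l ↔ T ≤ col p := fun p => by
    rw [S.mem_list]
    exact ⟨fun h => h.1, fun h => ⟨h, fun y _ hy => hQ y hy⟩⟩
  obtain ⟨d, h1, h2, h3, h4, -, h6, h7⟩ := S.exists_adjust_list H hQ l (fun p hp => (hl p).1 hp)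
    (by convert S.spread)
  have hK0 : (0 : ℤ) < K := by have := H.four_mul_lt; omega
  have hd : ∀ x y, G.Adj x y → 1 ≤ d s(x, y) ∧ d s(x, y) ≤ 2 * K + 4 * μ + 1 := by
    intro x y hxy
    rcases lt_or_ge (col x) T with hx | hx <;> rcases lt_or_ge (col y) T with hy | hy
    · rw [h2 x y hxy (by rw [hl]; omega) (by rw [hl]; omega)]
      have := S.low x y hxy hx hy
      constructor <;> linarith
    · have := h4 x y hxy hx hy
      constructor <;> linarith
    · have := h4 y x hxy.symm hy hx
      rw [Sym2.eq_swap]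
      constructor <;> linarith
    · rw [h3 x y hxy hx hy, S.high x y hxy hx hy]
      constructor <;> linarith
  have hblock : ∀ v, col v < T → ¬ (q : ℤ) ∣ G.intWeight d v / (2 * K) ∧
      a v = 2 * K * (G.intWeight d v / (2 * K)) + a v % (2 * K) := by
    intro v hv
    obtain ⟨e1, e2⟩ := S.not_dvd v (hQ v hv)
    have e3 : (a v + K) / (2 * K) = a v / (2 * K) := by
      have e4 := Int.mul_ediv_add_emod (a v) (2 * K)
      have e5 := Int.emod_nonneg (a v) (show (2 * K : ℤ) ≠ 0 by omega)
      have : a v + K = 2 * K * (a v / (2 * K)) + (a v % (2 * K) + K) := by linarith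
      have e6 : (a v % (2 * K) + K) / (2 * K) = 0 :=
        Int.ediv_eq_zero_of_lt (by linarith) (by linarith)
      rw [this, Int.mul_add_ediv_left _ _ (by omega), e6, add_zero]
    have e4 := Int.mul_ediv_add_emod (a v) (2 * K)
    rcases h1 v hv with h | h
    · rw [h]
      exact ⟨e1, e4.symm⟩
    · rw [h, e3]
      exact ⟨e1, e4.symm⟩
  have hne : ∀ u v, G.IsDistantNeighbor r u v → G.intWeight d u ≠ G.intWeight d v := by
    intro u v huv heq
    rcases lt_or_ge (col u) T with hu | hu <;> rcases lt_or_ge (col v) T with hv | hv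
    · have hau := (hblock u hu).2
      have hav := (hblock v hv).2
      have hmu := (S.not_dvd u (hQ u hu)).2
      have hmv := (S.not_dvd v (hQ v hv)).2
      have hmu' := Int.emod_nonneg (a u) (show (2 * K : ℤ) ≠ 0 by omega)
      have hmv' := Int.emod_nonneg (a v) (show (2 * K : ℤ) ≠ 0 by omega)
      rw [heq] at hau
      refine S.ne u (hQ u hu) v (hQ v hv) huv ?_
      rcases h1 u hu with h | h <;> rcases h1 v hv with h' | h' <;> omega
    · exact (hblock u hu).1 (heq ▸ h6 v ((hl v).2 hv))
    · exact (hblock v hv).1 (heq ▸ h6 u ((hl u).2 hu))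
    · exact h7 u ((hl u).2 hu) v ((hl v).2 hv) huv heq
  have hw : ∀ v, (G.weightedDegree (fun e => (d e).toNat) v : ℤ) = G.intWeight d v := by
    intro v
    unfold weightedDegree intWeight
    rw [Nat.cast_sum]
    refine Finset.sum_congr rfl fun u hu => ?_
    have := (hd v u ((G.mem_neighborFinset _ _).1 hu)).1
    exact Int.toNat_of_nonneg (by omega)
  refine ⟨fun e => (d e).toNat, ?_, fun u v huv h => ?_⟩
  · intro e
    induction e using Sym2.ind with
    | _ x y =>
      intro he
      have := hd x y he
      dsimp only
      omega
  · refine hne u v huv ?_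
    rw [← hw, ← hw, h]

end Algorithm

end SimpleGraph

/-! ### Choice of the parameters -/

namespace SimpleGraph

/-- Numerical estimate for the vertices of the last part. -/
theorem div_add_one_lt_div {s q m d : ℕ} (hs : 64 ≤ s) (hq : q = 16 * s)
    (hd : (2 ^ 24 : ℝ) * s ^ 4 ≤ d) (hm : (d : ℝ) / 2 ≤ m) :
    d / (128 * s) + 1 < m / (2 * q) := by
  have hsR : (64 : ℝ) ≤ s := by exact_mod_cast hs
  have hd' : 256 * s < d := by
    have h5 : (256 * s : ℝ) < d := by
      refine lt_of_lt_of_le ?_ hd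
      have h1 : (1 : ℝ) ≤ (s : ℝ) ^ 3 := one_le_pow₀ (by linarith)
      have h2 : (s : ℝ) * 1 ≤ s * s ^ 3 := by gcongr
      have h3 : (s : ℝ) ^ 4 = s * s ^ 3 := by ring
      rw [h3]
      linarith
    exact_mod_cast h5
  have hm' : d ≤ 2 * m := by
    have : (d : ℝ) ≤ 2 * m := by linarith
    exact_mod_cast this
  rw [hq]
  have h1 := Nat.mul_div_le d (128 * s)
  have h2 := Nat.lt_mul_div_succ m (show 0 < 2 * (16 * s) by omega)
  -- With q = 16s one has 2q · d/(128s) = d/4, half of the d/2 available; d > 256s absorbs the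
  -- rounding.
  by_contra hcon
  push Not at hcon
  have h3 : 2 * (16 * s) * (m / (2 * (16 * s)) + 1) ≤
      2 * (16 * s) * (d / (128 * s) + 1 + 1) := by gcongr
  have h4 : 4 * (2 * (16 * s) * (d / (128 * s) + 1 + 1)) =
      128 * s * (d / (128 * s)) + 256 * s := by ring
  omega

/-- Numerical estimate for the vertices outside the last part: the interval of reachable weights
contains more admissible values than there are vertices to be avoided. -/
theorem exists_period_count {s N P K μ q n b i k : ℕ} {d : ℝ} (hs : 64 ≤ s)
    (hNR : (N : ℝ) = 2 ^ 18 * s ^ 3) (hqR : (q : ℝ) = 16 * s) (hK0 : 0 < K)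
    (hK_le : (K : ℝ) ≤ 3 * P) (hK_ge : 2 * P * (q : ℝ) ≤ K * ((q : ℝ) - 1))
    (hμn : P * d / (2 ^ 14 * s ^ 3) ≤ μ * n)
    (hPd : (2 : ℝ) ^ 10 * (s * P) ≤ P * d / (2 ^ 14 * s ^ 3))
    (hb : d * i / N - d / N ≤ b) (hk : (k : ℝ) < d * P * ((i : ℝ) + 1) / N + d * P / N) :
    ∃ Y, 2 * K * q * (Y + 1) ≤ K * b + 2 * μ * n + 1 ∧ k < Y * (q - 1) * K := by
  have hsR : (64 : ℝ) ≤ s := by exact_mod_cast hs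
  have hs0R : (0 : ℝ) < s := by linarith
  have hN0R : (0 : ℝ) < N := by rw [hNR]; positivity
  have hq0 : (0 : ℝ) < q := by rw [hqR]; positivity
  have hq0' : 0 < q := by exact_mod_cast hq0
  have hq2 : (q : ℝ) ≤ 2 * (q - 1) := by rw [hqR]; linarith
  have hq1R : (0 : ℝ) < (q : ℝ) - 1 := by linarith
  have hKq : 0 < 2 * K * q := by positivity
  set L := K * b + 2 * μ * n + 1 with hL
  have hqK : (q : ℝ) * K ≤ 48 * (s * P) := by
    have : (s : ℝ) * K ≤ s * (3 * P) := by gcongr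
    rw [hqR]
    linarith
  have hY0 : 2 * K * q ≤ L := by
    have h1 : (2 * K * q : ℝ) ≤ L := by
      rw [hL]
      push_cast
      have h2 : (0 : ℝ) ≤ K * b := by positivity
      have h3 : (0 : ℝ) ≤ s * P := by positivity
      linarith
    exact_mod_cast h1
  have hYdiv : 1 ≤ L / (2 * K * q) := (Nat.one_le_div_iff hKq).2 hY0
  obtain ⟨Y, hYe⟩ : ∃ Y, L / (2 * K * q) = Y + 1 := ⟨L / (2 * K * q) - 1, by omega⟩
  refine ⟨Y, by rw [← hYe]; exact Nat.mul_div_le _ _, ?_⟩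
  have hY := Nat.lt_mul_div_succ L hKq
  rw [hYe] at hY
  have hYR : (K * b + 2 * μ * n : ℝ) ≤ 2 * K * q * (Y + 2) := by
    have : (L : ℝ) < 2 * K * q * (Y + 1 + 1) := by exact_mod_cast hY
    rw [hL] at this
    push_cast at this
    linarith
  have h1 : (K * b + 2 * μ * n) * ((q : ℝ) - 1) ≤
      2 * q * (Y * ((q : ℝ) - 1) * K + 2 * (q * K)) := by
    have h2 : (K * b + 2 * μ * n) * ((q : ℝ) - 1) ≤
        2 * K * q * (Y + 2) * ((q : ℝ) - 1) := by gcongr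
    have h3 : 2 * K * q * (Y + 2) * ((q : ℝ) - 1) =
        2 * q * (Y * ((q : ℝ) - 1) * K + 2 * (q * K)) - 4 * q * K := by ring
    have h4 : (0 : ℝ) ≤ q * K := by positivity
    linarith
  -- The lower bound on K is made for this: the admissible share (q - 1)/(2q) of Kb is still at
  -- least Pb.
  have h2 : 2 * q * (P * b + μ * n / 2) ≤ (K * b + 2 * μ * n) * ((q : ℝ) - 1) := by
    have h3 : 2 * P * (q : ℝ) * b ≤ K * ((q : ℝ) - 1) * b := by gcongr
    have h4 : (q : ℝ) * (μ * n) ≤ 2 * (q - 1) * (μ * n) := by gcongr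
    linarith
  have h3 : P * b + μ * n / 2 ≤ Y * ((q : ℝ) - 1) * K + 2 * (q * K) :=
    le_of_mul_le_mul_left (h2.trans h1) (by positivity)
  have h4 : P * (d * i / N - d / N) ≤ P * b := by gcongr
  -- The surplus μn/2 ≥ 8Pd/N covers both the error 3Pd/N of the balanced colouring and the rounding
  -- loss 2qK ≤ 96sP, as Pd/N ≥ 64sP.
  have h6 : 16 * (P * d / N) = P * d / (2 ^ 14 * s ^ 3) := by
    rw [hNR]
    field_simp
    ring
  have h7 : d * P * ((i : ℝ) + 1) / N + d * P / N =
      P * (d * i / N - d / N) + 3 * (P * d / N) := by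
    field_simp
    ring
  have h8 : ((q - 1 : ℕ) : ℝ) = (q : ℝ) - 1 := by
    rw [Nat.cast_sub (by omega)]
    norm_num
  have h9 : (0 : ℝ) ≤ s * P := by positivity
  have h10 : (k : ℝ) < Y * ((q - 1 : ℕ) : ℝ) * K := by
    rw [h8]
    linarith
  exact_mod_cast h10

section Parameters

variable {V : Type*} [Fintype V] (G : SimpleGraph V) [DecidableRel G.Adj]

set_option maxHeartbeats 400000 in
open Classical in
/-- The conditions for the algorithm hold for suitable parameters if all initial and final segments
of the colours occupy about their fair share of the neighbourhoods. -/
theorem isBalancedSplit_of_balanced {r s N T P K μ q : ℕ} (hs : 64 ≤ s)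
    (hN : N = 2 ^ 18 * s ^ 3) (hT : T + 2 ^ 8 * s = N) (hPs : s ^ 8 ≤ P) (hq : q = 16 * s) (hK : K = 2 * P + 2 * P / (q - 1) + 1)
    (hμ : μ = P / (4 * s)) (hdeg : ∀ v, s ^ 8 ≤ G.degree v) (col : V → Fin N)
    (hnbr : ∀ v, ∀ t ≤ N,
      (((G.neighborFinset v).filter fun u => (col u : ℕ) < t).card : ℝ) <
        G.degree v * (t / N) + G.degree v / N ∧
      (((G.neighborFinset v).filter fun u => t ≤ (col u : ℕ)).card : ℝ) <
        G.degree v * (1 - t / N) + G.degree v / N)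
    (hnear : ∀ v, ∀ t ≤ N,
      (((Finset.univ.filter fun u => G.IsDistantNeighbor r v u).filter
        fun u => (col u : ℕ) < t).card : ℝ) <
        (G.degree v * P : ℝ) * (t / N) + (G.degree v * P : ℝ) / N ∧
      (((Finset.univ.filter fun u => G.IsDistantNeighbor r v u).filter
        fun u => t ≤ (col u : ℕ)).card : ℝ) <
        (G.degree v * P : ℝ) * (1 - t / N) + (G.degree v * P : ℝ) / N) :
    G.IsBalancedSplit r (fun v => (col v : ℕ)) T K μ q (fun v => G.degree v / (128 * s)) := by
  have hs0 : 0 < s := by omega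
  have hsR : (64 : ℝ) ≤ s := by exact_mod_cast hs
  have hs0R : (0 : ℝ) < s := by linarith
  have hs2 : (1 : ℝ) ≤ (s : ℝ) ^ 2 := one_le_pow₀ (by linarith)
  have hs3 : (s : ℝ) ^ 2 ≤ (s : ℝ) ^ 3 := pow_le_pow_right₀ (by linarith) (by norm_num)
  have hs34 : (s : ℝ) ^ 3 ≤ (s : ℝ) ^ 4 := pow_le_pow_right₀ (by linarith) (by norm_num)
  have hs8 : (64 : ℕ) * s ≤ s ^ 8 := by
    calc 64 * s ≤ s ^ 7 * s := Nat.mul_le_mul_right _ (hs.trans (Nat.le_self_pow (by norm_num) s))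
      _ = s ^ 8 := by ring
  have hP0 : 64 * s ≤ P := hs8.trans hPs
  have hPR : (64 : ℝ) * s ≤ P := by exact_mod_cast hP0
  have hP0R : (0 : ℝ) < P := by linarith
  have hq1 : 0 < q - 1 := by omega
  have hN0 : 0 < N := by rw [hN]; positivity
  have hNR : (N : ℝ) = 2 ^ 18 * s ^ 3 := by rw [hN]; push_cast; ring
  have hN0R : (0 : ℝ) < N := by exact_mod_cast hN0
  have hTN : T ≤ N := by omega
  -- The last part takes 2^8 s of the N colours, a share well above the error 1/N.
  have hTR : 1 - (T : ℝ) / N = 1 / (2 ^ 10 * s ^ 2) := by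
    have : (T : ℝ) = N - 2 ^ 8 * s := by
      have : (T : ℝ) + 2 ^ 8 * s = N := by exact_mod_cast hT
      linarith
    rw [this, hNR]
    field_simp
    norm_num
  have hinvN : 1 / (N : ℝ) ≤ 1 / (2 ^ 11 * s ^ 2) := by
    rw [hNR]
    refine one_div_le_one_div_of_le (by positivity) ?_
    linarith
  have hhalf : 1 / (2 ^ 10 * (s : ℝ) ^ 2) = 2 * (1 / (2 ^ 11 * (s : ℝ) ^ 2)) := by
    field_simp
  have hdR : ∀ v, (s : ℝ) ^ 8 ≤ G.degree v := fun v => by exact_mod_cast hdeg v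
  have hs4 : (2 ^ 24 : ℝ) ≤ (s : ℝ) ^ 4 := by
    calc (2 ^ 24 : ℝ) = 64 ^ 4 := by norm_num
      _ ≤ (s : ℝ) ^ 4 := by gcongr
  have hd4 : ∀ v, (2 ^ 24 : ℝ) * s ^ 4 ≤ G.degree v := fun v => by
    refine le_trans ?_ (hdR v)
    calc (2 ^ 24 : ℝ) * (s : ℝ) ^ 4 ≤ (s : ℝ) ^ 4 * (s : ℝ) ^ 4 := by gcongr
      _ = (s : ℝ) ^ 8 := by ring
  have hd0 : ∀ v, (0 : ℝ) < G.degree v := fun v => lt_of_lt_of_le (by positivity) (hdR v)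
  -- the complementary lower bounds on the numbers of neighbours
  have hcompl : ∀ v t, (((G.neighborFinset v).filter fun u => (col u : ℕ) < t).card : ℝ) +
      (((G.neighborFinset v).filter fun u => t ≤ (col u : ℕ)).card : ℝ) = G.degree v := by
    intro v t
    have := Finset.card_filter_add_card_filter_not (s := G.neighborFinset v)
      (fun u => (col u : ℕ) < t)
    simp only [not_lt] at this
    rw [card_neighborFinset_eq_degree] at this
    exact_mod_cast this
  have hK_le : (K : ℝ) ≤ 3 * P := by
    have h1 : 2 * P / (q - 1) ≤ 2 * P / 4 := Nat.div_le_div_left (by omega) (by norm_num)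
    have h2 : K ≤ 3 * P := by omega
    exact_mod_cast h2
  have hK_ge : 2 * P * (q : ℝ) ≤ K * ((q : ℝ) - 1) := by
    have h1 := Nat.lt_mul_div_succ (2 * P) hq1
    have h2 : 2 * P * q ≤ K * (q - 1) := by
      obtain ⟨m, hm⟩ : ∃ m, q = m + 1 := ⟨q - 1, by omega⟩
      rw [hm] at h1 hK ⊢
      simp only [Nat.add_sub_cancel] at h1 hK ⊢
      rw [hK]
      nlinarith
    have h3 : ((q - 1 : ℕ) : ℝ) = (q : ℝ) - 1 := by
      rw [Nat.cast_sub (by omega)]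
      norm_num
    rw [← h3]
    exact_mod_cast h2
  have hqR : (q : ℝ) = 16 * s := by rw [hq]; push_cast; ring
  have hμ_ge : (P : ℝ) / (8 * s) ≤ μ := by
    have h1 := Nat.lt_mul_div_succ P (show 0 < 4 * s by omega)
    rw [← hμ] at h1
    have h2 : (P : ℝ) < 4 * s * (μ + 1) := by exact_mod_cast h1
    rw [div_le_iff₀ (by positivity)]
    nlinarith
  have hμ_ge' : (P : ℝ) / (4 * s) < μ + 1 := by
    have h1 := Nat.lt_mul_div_succ P (show 0 < 4 * s by omega)
    rw [← hμ] at h1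
    have h2 : (P : ℝ) < 4 * s * (μ + 1) := by exact_mod_cast h1
    rw [div_lt_iff₀ (by positivity)]
    linarith
  have hμK : 4 * μ < K := by
    have h1 : μ ≤ P / 4 := by
      rw [hμ]
      exact Nat.div_le_div_left (by omega) (by norm_num)
    have h2 : 2 * P < K := by rw [hK]; exact Nat.lt_succ_of_le (Nat.le_add_right _ _)
    omega
  have hK0 : 0 < K := by rw [hK]; omega
  have hK0R : (0 : ℝ) < K := by exact_mod_cast hK0
  refine ⟨hμK, by omega, ?_, ?_, ?_⟩
  · intro v hv
    set n := ((G.neighborFinset v).filter fun u => T ≤ (col u : ℕ)).card with hn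
    set b := ((G.neighborFinset v).filter fun u => (col u : ℕ) < col v).card with hb
    set d : ℝ := (G.degree v : ℝ) with hd
    have hn_ge : d / (2 ^ 11 * s ^ 2) ≤ n := by
      have h1 := (hnbr v T hTN).1
      have h2 := hcompl v T
      have h3 : (T : ℝ) / N = 1 - 1 / (2 ^ 10 * s ^ 2) := by linarith
      rw [h3, hhalf] at h1
      have h4 : d * (1 / N) ≤ d * (1 / (2 ^ 11 * s ^ 2)) := by gcongr
      rw [← hd] at h1 h2
      rw [div_eq_mul_one_div d N] at h1
      rw [div_eq_mul_one_div]
      linarith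
    have hb_ge : d * ((col v : ℕ) : ℝ) / N - d / N ≤ b := by
      have h1 := (hnbr v (col v) (col v).2.le).2
      have h2 := hcompl v (col v)
      rw [← hd] at h1 h2
      have h3 : d * (1 - ((col v : ℕ) : ℝ) / N) = d - d * ((col v : ℕ) : ℝ) / N := by ring
      rw [h3] at h1
      linarith
    have hμn : P * d / (2 ^ 14 * s ^ 3) ≤ μ * n := by
      have e : P * d / (2 ^ 14 * s ^ 3) = P / (8 * s) * (d / (2 ^ 11 * s ^ 2)) := by
        field_simp
        norm_num
      rw [e]
      gcongr
    have hPd : (2 : ℝ) ^ 10 * (s * P) ≤ P * d / (2 ^ 14 * s ^ 3) := by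
      rw [le_div_iff₀ (by positivity)]
      calc (2 : ℝ) ^ 10 * (s * P) * (2 ^ 14 * s ^ 3) = P * (2 ^ 24 * s ^ 4) := by ring
        _ ≤ P * d := by gcongr; exact hd4 v
    have hn2 : 2 ≤ n := by
      have h1 : (2 : ℝ) ≤ d / (2 ^ 11 * s ^ 2) := by
        rw [le_div_iff₀ (by positivity)]
        refine le_trans ?_ (hd4 v)
        linarith
      exact_mod_cast h1.trans hn_ge
    have hsP : (64 : ℝ) * P ≤ s * P := by gcongr
    refine ⟨hn2, ?_, ?_⟩
    · have h1 : (K : ℝ) ≤ 2 * μ * n + 1 := by linarith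
      exact_mod_cast h1
    · refine exists_period_count hs hNR hqR hK0 hK_le hK_ge hμn hPd hb_ge ?_
      -- Vertices of the same colour may be handled before v, so the segment includes the colour of
      -- v.
      have h1 := (hnear v (col v + 1) (col v).2).1
      rw [Finset.filter_filter] at h1
      simp only [Nat.lt_succ_iff] at h1
      push_cast at h1
      rw [mul_div_assoc]
      exact h1
  · intro p hp
    have h1 := (hnear p T hTN).2
    rw [Finset.filter_filter] at h1
    rw [Finset.filter_filter]
    simp only [and_comm] at h1 ⊢
    set d : ℝ := (G.degree p : ℝ) with hd
    -- In units of dP/(2^11 s²): 2 for the share and at most 1 for the error, against 4 on the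
    -- right.
    have h2 : (d * P : ℝ) * (1 - T / N) + d * P / N ≤ P / (4 * s) * (d / (128 * s)) := by
      rw [hTR, hhalf, div_eq_mul_one_div (d * P) (N : ℝ)]
      have h3 : d * P * (1 / N) ≤ d * P * (1 / (2 ^ 11 * s ^ 2)) := by
        have := hd0 p
        gcongr
      have h4 : P / (4 * s) * (d / (128 * s)) = 4 * (d * P * (1 / (2 ^ 11 * s ^ 2))) := by
        field_simp
        ring
      have h5 : 0 ≤ d * P * (1 / (2 ^ 11 * s ^ 2)) := by
        have := hd0 p
        positivity
      rw [h4]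
      linarith
    have h3 : d / (128 * s) < ((G.degree p / (128 * s) : ℕ) : ℝ) + 1 := by
      have h4 := Nat.lt_mul_div_succ (G.degree p) (show 0 < 128 * s by omega)
      have h5 : d < 128 * s * (((G.degree p / (128 * s) : ℕ) : ℝ) + 1) := by
        rw [hd]
        exact_mod_cast h4
      rw [div_lt_iff₀ (by positivity)]
      linarith
    have h4 : (P : ℝ) / (4 * s) * (d / (128 * s)) ≤
        (μ + 1) * (((G.degree p / (128 * s) : ℕ) : ℝ) + 1) := by
      have := hd0 p
      gcongr
    have h5 := (h1.trans_le h2).trans_le h4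
    exact_mod_cast h5
  · intro p hp
    set d : ℝ := (G.degree p : ℝ) with hd
    set m := ((G.neighborFinset p).filter fun u => (col u : ℕ) < T).card with hm
    have h1 : d / 2 ≤ m := by
      have h2 := (hnbr p T hTN).2
      have h3 := hcompl p T
      rw [← hd] at h2 h3
      rw [hTR, hhalf, div_eq_mul_one_div d (N : ℝ)] at h2
      have h4 : d * (1 / N) ≤ d * (1 / (2 ^ 11 * s ^ 2)) := by
        have := hd0 p
        gcongr
      have h5 : 1 / (2 ^ 11 * (s : ℝ) ^ 2) ≤ 1 / 6 :=
        one_div_le_one_div_of_le (by norm_num) (by linarith)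
      have h6 : d * (1 / (2 ^ 11 * s ^ 2)) ≤ d * (1 / 6) := by
        have := hd0 p
        gcongr
      linarith
    exact ⟨m / (2 * q), div_add_one_lt_div hs hq (hd4 p) h1, Nat.mul_div_le _ _⟩

end Parameters

end SimpleGraph

/-! ### The local lemma condition and the final bounds -/

namespace SimpleGraph

open Classical in
/-- The vertices whose `r`-neighbourhood meets that of `v` are few. -/
theorem card_filter_not_disjoint_le {V : Type*} [Fintype V] (G : SimpleGraph V)
    [DecidableRel G.Adj] {r : ℕ} (hr : 1 ≤ r) (F : V → Finset V)
    (hF : ∀ v, ∀ u ∈ F v, G.edist v u ≤ (r : ℕ∞)) (v : V) :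
    (Finset.univ.filter fun w => ¬ Disjoint (F v) (F w)).card ≤ G.maxDegree ^ (2 * r) + 1 := by
  have hsub : (Finset.univ.filter fun w => ¬ Disjoint (F v) (F w)) ⊆
      insert v (Finset.univ.filter fun w => G.IsDistantNeighbor (2 * r) v w) := by
    intro w hw
    obtain ⟨u, hu, hu'⟩ := Finset.not_disjoint_iff.1 (Finset.mem_filter.1 hw).2
    rw [Finset.mem_insert]
    by_cases hwv : w = v
    · exact Or.inl hwv
    · refine Or.inr (Finset.mem_filter.2 ⟨Finset.mem_univ _, Ne.symm hwv, ?_⟩)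
      calc G.edist v w ≤ G.edist v u + G.edist u w := G.edist_triangle
        _ ≤ r + r := add_le_add (hF v u hu) (by rw [edist_comm]; exact hF w u hu')
        _ = ((2 * r : ℕ) : ℕ∞) := by push_cast; rw [two_mul]
  refine (Finset.card_le_card hsub).trans ((Finset.card_insert_le _ _).trans ?_)
  gcongr
  refine (G.card_filter_isDistantNeighbor_le (2 * r) (by omega) v).trans ?_
  calc G.degree v * G.maxDegree ^ (2 * r - 1) ≤ G.maxDegree * G.maxDegree ^ (2 * r - 1) :=
        Nat.mul_le_mul_right _ (G.degree_le_maxDegree v)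
    _ = G.maxDegree ^ (2 * r) := by rw [← pow_succ', Nat.sub_add_cancel (by omega)]

/-- The numerical condition of the local lemma. -/
theorem local_lemma_bound {r s Δ : ℕ} (hs : 2 ^ 35 * (27 + 4 * r) ≤ s)
    (hΔ : (Δ : ℝ) ≤ Real.exp (s + 1)) :
    4 * (4 * (((2 ^ 18 * s ^ 3 : ℕ) : ℝ) + 1) *
      Real.exp (-2 * (s : ℝ) ^ 8 / ((2 ^ 18 * s ^ 3 : ℕ) : ℝ) ^ 2)) *
      ((Δ ^ (2 * r) + 1 : ℕ) : ℝ) ≤ 1 := by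
  have hsR : (2 ^ 35 : ℝ) * (27 + 4 * r) ≤ s := by exact_mod_cast hs
  have hr0 : (0 : ℝ) ≤ r := Nat.cast_nonneg r
  have hs1 : (1 : ℝ) ≤ s := by linarith
  have hs0 : (0 : ℝ) < s := by linarith
  -- The exponent is quadratic in s ≈ ln Δ, whereas Δ^(2r) and the polynomial factors contribute
  -- only linear terms.
  have e1 : -2 * (s : ℝ) ^ 8 / ((2 ^ 18 * s ^ 3 : ℕ) : ℝ) ^ 2 = -((s : ℝ) ^ 2 / 2 ^ 35) := by
    push_cast
    field_simp
    norm_num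
  have hs3 : (1 : ℝ) ≤ (s : ℝ) ^ 3 := one_le_pow₀ hs1
  have h1 : 4 * (((2 ^ 18 * s ^ 3 : ℕ) : ℝ) + 1) ≤ 2 ^ 21 * (s : ℝ) ^ 3 := by
    push_cast
    linarith
  have h2 : ((Δ ^ (2 * r) + 1 : ℕ) : ℝ) ≤ 2 * Real.exp (2 * r * (s + 1)) := by
    push_cast
    have h3 : (Δ : ℝ) ^ (2 * r) ≤ Real.exp (2 * r * (s + 1)) := by
      calc (Δ : ℝ) ^ (2 * r) ≤ Real.exp (s + 1) ^ (2 * r) := by gcongr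
        _ = Real.exp (2 * r * (s + 1)) := by
            rw [← Real.exp_nat_mul]
            push_cast
            rfl
    have h4 : (1 : ℝ) ≤ Real.exp (2 * r * (s + 1)) := Real.one_le_exp (by positivity)
    linarith
  have h3 : (s : ℝ) ^ 3 ≤ Real.exp (3 * s) := by
    have h4 : (s : ℝ) ≤ Real.exp s := by linarith [Real.add_one_le_exp (s : ℝ)]
    calc (s : ℝ) ^ 3 ≤ Real.exp s ^ 3 := by gcongr
      _ = Real.exp (3 * s) := by
          rw [← Real.exp_nat_mul]
          push_cast
          rfl
  have h4 : (2 : ℝ) ^ 24 ≤ Real.exp 24 := by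
    have h5 : (2 : ℝ) ≤ Real.exp 1 := by linarith [Real.add_one_le_exp (1 : ℝ)]
    calc (2 : ℝ) ^ 24 ≤ Real.exp 1 ^ 24 := by gcongr
      _ = Real.exp 24 := by
          rw [← Real.exp_nat_mul]
          norm_num
  rw [e1]
  calc 4 * (4 * (((2 ^ 18 * s ^ 3 : ℕ) : ℝ) + 1) * Real.exp (-((s : ℝ) ^ 2 / 2 ^ 35))) *
        ((Δ ^ (2 * r) + 1 : ℕ) : ℝ)
      ≤ 4 * (2 ^ 21 * (s : ℝ) ^ 3 * Real.exp (-((s : ℝ) ^ 2 / 2 ^ 35))) *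
        (2 * Real.exp (2 * r * (s + 1))) := by gcongr
    _ = 2 ^ 24 * (s : ℝ) ^ 3 * Real.exp (2 * r * (s + 1)) * Real.exp (-((s : ℝ) ^ 2 / 2 ^ 35)) := by
        ring
    _ ≤ Real.exp 24 * Real.exp (3 * s) * Real.exp (2 * r * (s + 1)) *
        Real.exp (-((s : ℝ) ^ 2 / 2 ^ 35)) := by gcongr
    _ = Real.exp (24 + 3 * s + 2 * r * (s + 1) + -((s : ℝ) ^ 2 / 2 ^ 35)) := by
        rw [← Real.exp_add, ← Real.exp_add, ← Real.exp_add]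
    _ ≤ 1 := by
        rw [Real.exp_le_one_iff]
        have h5 : (27 + 4 * r : ℝ) * s ≤ (s : ℝ) ^ 2 / 2 ^ 35 := by
          rw [le_div_iff₀ (by positivity)]
          calc (27 + 4 * r : ℝ) * s * 2 ^ 35 = (2 : ℝ) ^ 35 * (27 + 4 * r) * (s : ℝ) := by ring
            _ ≤ (s : ℝ) * (s : ℝ) := by gcongr
            _ = (s : ℝ) ^ 2 := by ring
        have h6 : (r : ℝ) * 1 ≤ r * s := by gcongr
        nlinarith

/-- The bound for graphs of large maximum degree. -/
theorem exists_isDistantIrregularColoring_of_floor_log {V : Type*} [Fintype V]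
    (G : SimpleGraph V) [DecidableRel G.Adj] {r s : ℕ} (hr : 2 ≤ r)
    (hs : s = ⌊Real.log (G.maxDegree : ℝ)⌋₊) (hs0 : 2 ^ 35 * (27 + 4 * r) ≤ s)
    (hδ : Real.log (G.maxDegree : ℝ) ^ 8 ≤ (G.minDegree : ℝ)) :
    ∃ k : ℕ, (∃ c, G.IsDistantIrregularColoring r k c) ∧
      (k : ℝ) < 4 * (G.maxDegree : ℝ) ^ (r - 1) * (1 + 1 / Real.log (G.maxDegree : ℝ)) + 12 := by
  classical
  have hs64 : 64 ≤ s := by omega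
  have hsR : (64 : ℝ) ≤ s := by exact_mod_cast hs64
  have hlog1 : (s : ℝ) ≤ Real.log (G.maxDegree : ℝ) := by
    rw [hs]
    exact Nat.floor_le (Nat.pos_of_floor_pos (by omega)).le
  have hlog2 : Real.log (G.maxDegree : ℝ) < s + 1 := by
    rw [hs]
    exact Nat.lt_floor_add_one _
  have hdeg : ∀ v, s ^ 8 ≤ G.degree v := by
    intro v
    have h1 : (s : ℝ) ^ 8 ≤ G.minDegree := le_trans (by gcongr) hδ
    have h2 : s ^ 8 ≤ G.minDegree := by exact_mod_cast h1
    exact h2.trans (G.minDegree_le_degree v)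
  have hΔ0 : 0 < G.maxDegree := by
    rcases Nat.eq_zero_or_pos G.maxDegree with h | h
    · rw [h] at hlog1
      simp only [Nat.cast_zero, Real.log_zero] at hlog1
      linarith
    · exact h
  have hΔexp : (G.maxDegree : ℝ) ≤ Real.exp (s + 1) := by
    rw [← Real.log_le_iff_le_exp (by exact_mod_cast hΔ0)]
    exact hlog2.le
  have hne : Nonempty V := by
    by_contra h
    rw [not_nonempty_iff] at h
    have : G.maxDegree = 0 := by
      simp [maxDegree]
    omega
  set P := G.maxDegree ^ (r - 1) with hP
  have hΔP : G.maxDegree ≤ P := Nat.le_self_pow (by omega) _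
  have hPs : s ^ 8 ≤ P := by
    obtain ⟨v⟩ := hne
    exact ((hdeg v).trans (G.degree_le_maxDegree v)).trans hΔP
  set N := 2 ^ 18 * s ^ 3 with hN
  have hNpos : 0 < N := by positivity
  have : NeZero N := ⟨hNpos.ne'⟩
  have hs8 : (0 : ℝ) < (s : ℝ) ^ 8 := by positivity
  set W : Bool → V → Finset V := fun b v =>
    if b then Finset.univ.filter fun u => G.IsDistantNeighbor r v u else G.neighborFinset v with hW
  set D : Bool → V → ℝ := fun b v =>
    if b then (G.degree v * P : ℝ) else (G.degree v : ℝ) with hD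
  have hP1 : (1 : ℝ) ≤ P := by exact_mod_cast hΔ0.trans_le hΔP
  have hdegR : ∀ v, (s : ℝ) ^ 8 ≤ G.degree v := fun v => by exact_mod_cast hdeg v
  obtain ⟨col, hcol⟩ := exists_balanced_coloring (N := N) W D
    (by
      intro b v
      cases b
      · simp [hW, hD]
      · simp only [hW, hD, if_true]
        exact_mod_cast G.card_filter_isDistantNeighbor_le r (by omega) v)
    ((s : ℝ) ^ 8) hs8
    (by
      intro b v
      have := hdegR v
      cases b
      · simpa [hD] using this
      · simp only [hD, if_true]
        nlinarith)
    (G.maxDegree ^ (2 * r) + 1) (by omega)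
    (fun v => G.card_filter_not_disjoint_le (by omega : 1 ≤ r)
      (fun v => W true v ∪ W false v) (by
        intro v u hu
        rcases Finset.mem_union.1 hu with h | h
        · exact (Finset.mem_filter.1 h).2.2
        · have h' : G.Adj v u := (G.mem_neighborFinset _ _).1 h
          refine (edist_le_one_iff_adj_or_eq.2 (Or.inl h')).trans ?_
          exact_mod_cast (by omega : 1 ≤ r)) v)
    (local_lemma_bound hs0 hΔexp)
  have hTle : 2 ^ 8 * s ≤ N := by
    rw [hN]
    have : s ≤ s ^ 3 := Nat.le_self_pow (by norm_num) s
    omega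
  have H := G.isBalancedSplit_of_balanced (r := r) (T := N - 2 ^ 8 * s) hs64 hN (by omega) hPs
    rfl rfl rfl hdeg col (fun v t ht => hcol false v t ht) (fun v t ht => hcol true v t ht)
  refine ⟨_, H.exists_isDistantIrregularColoring, ?_⟩
  have h1 : ((2 * P / (16 * s - 1) : ℕ) : ℝ) ≤ 2 * P / (15 * s) := by
    refine Nat.cast_div_le.trans ?_
    push_cast [Nat.cast_sub (show 1 ≤ 16 * s by omega)]
    gcongr
    linarith
  have h2 : ((P / (4 * s) : ℕ) : ℝ) ≤ P / (4 * s) := by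
    refine Nat.cast_div_le.trans ?_
    push_cast
    rfl
  have h3 : (P : ℝ) / (s + 1) ≤ P * (1 / Real.log (G.maxDegree : ℝ)) := by
    rw [mul_one_div]
    gcongr
    linarith
  have hPc : (G.maxDegree : ℝ) ^ (r - 1) = P := by rw [hP]; push_cast; rfl
  rw [hPc]
  push_cast
  -- Up to an additive constant, 2K + 4μ + 1 exceeds 4P by at most the left side, which is
  -- 19P/(15s).
  have h4 : 2 * (2 * (P : ℝ) / (15 * s)) + 4 * (P / (4 * s)) ≤ 4 * (P / (s + 1)) := by
    have e1 : 2 * (2 * (P : ℝ) / (15 * s)) + 4 * (P / (4 * s)) = 19 * P / (15 * s) := by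
      field_simp
      norm_num
    have e2 : 4 * ((P : ℝ) / (s + 1)) = 4 * P / (s + 1) := by ring
    rw [e1, e2, div_le_div_iff₀ (by positivity) (by positivity)]
    have : (P : ℝ) ≤ P * s := by nlinarith
    nlinarith
  linarith

theorem distantIrregularityStrength_le {V : Type*} [Fintype V] (G : SimpleGraph V)
    [DecidableRel G.Adj] {r k : ℕ} (h : ∃ c, G.IsDistantIrregularColoring r k c) :
    ∃ k' : ℕ, G.distantIrregularityStrength r = (k' : ℕ∞) ∧ k' ≤ k := by
  have hle : G.distantIrregularityStrength r ≤ (k : ℕ∞) := sInf_le ⟨k, rfl, h⟩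
  obtain ⟨k', hk'⟩ := ENat.ne_top_iff_exists.1 (ne_top_of_le_ne_top (ENat.natCast_ne_top k) hle)
  refine ⟨k', hk'.symm, ?_⟩
  rw [← hk'] at hle
  exact_mod_cast hle

end SimpleGraph

open SimpleGraph in
theorem theorem3p1 (r : ℕ) (hr : 2 ≤ r) :
    (∃ Δ₀ : ℕ, ∀ (V : Type u) [Fintype V] (G : SimpleGraph V) [DecidableRel G.Adj],
      Δ₀ ≤ G.maxDegree →
      Real.log (G.maxDegree : ℝ) ^ 8 ≤ (G.minDegree : ℝ) →
      ∃ k : ℕ, G.distantIrregularityStrength r = (k : ℕ∞) ∧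
        (k : ℝ) < 4 * (G.maxDegree : ℝ) ^ (r - 1) * (1 + 1 / Real.log (G.maxDegree : ℝ)) + 12) ∧
    (∃ ε : ℕ → ℝ, Filter.Tendsto ε Filter.atTop (nhds 0) ∧
      ∀ (V : Type u) [Fintype V] (G : SimpleGraph V) [DecidableRel G.Adj],
        Real.log (G.maxDegree : ℝ) ^ 8 ≤ (G.minDegree : ℝ) →
        G.NoIsolatedEdges →
        ∃ k : ℕ, G.distantIrregularityStrength r = (k : ℕ∞) ∧
          (k : ℝ) ≤ (4 + ε G.maxDegree) * (G.maxDegree : ℝ) ^ (r - 1)) := by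
  set Δ₀ : ℕ := ⌈Real.exp ((2 ^ 35 * (27 + 4 * r) : ℕ) : ℝ)⌉₊ with hΔ₀
  have hlarge : ∀ (V : Type u) [Fintype V] (G : SimpleGraph V) [DecidableRel G.Adj],
      Δ₀ ≤ G.maxDegree →
      Real.log (G.maxDegree : ℝ) ^ 8 ≤ (G.minDegree : ℝ) →
      ∃ k : ℕ, G.distantIrregularityStrength r = (k : ℕ∞) ∧
        (k : ℝ) < 4 * (G.maxDegree : ℝ) ^ (r - 1) *
          (1 + 1 / Real.log (G.maxDegree : ℝ)) + 12 := by
    intro V _ G _ hΔ hδ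
    have h1 : Real.exp ((2 ^ 35 * (27 + 4 * r) : ℕ) : ℝ) ≤ G.maxDegree :=
      (Nat.le_ceil _).trans (by exact_mod_cast hΔ)
    have h2 : 2 ^ 35 * (27 + 4 * r) ≤ ⌊Real.log (G.maxDegree : ℝ)⌋₊ := by
      apply Nat.le_floor
      rw [Real.le_log_iff_exp_le ((Real.exp_pos _).trans_le h1)]
      exact h1
    obtain ⟨k, hk, hk'⟩ := G.exists_isDistantIrregularColoring_of_floor_log hr rfl h2 hδ
    obtain ⟨k', h3, h4⟩ := G.distantIrregularityStrength_le hk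
    exact ⟨k', h3, lt_of_le_of_lt (by exact_mod_cast h4) hk'⟩
  -- The term 12/n absorbs the additive 12, because n ≤ n^(r-1). Below Δ₀ the crude bound is taken,
  -- which does not affect the limit.
  refine ⟨⟨Δ₀, hlarge⟩, fun n => if Δ₀ ≤ n then 4 / Real.log n + 12 / n else
    2 ^ Fintype.card (Sym2 (Fin (n * n ^ r + 1))), ?_, ?_⟩
  · have h1 : Filter.Tendsto (fun n : ℕ => 4 / Real.log (n : ℝ) + 12 / (n : ℝ)) Filter.atTop
        (nhds (0 + 0)) :=
      (((Real.tendsto_log_atTop.comp tendsto_natCast_atTop_atTop).const_div_atTop 4)).add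
        (tendsto_natCast_atTop_atTop.const_div_atTop 12)
    rw [add_zero] at h1
    refine h1.congr' ?_
    filter_upwards [Filter.eventually_ge_atTop Δ₀] with n hn
    rw [if_pos hn]
  · intro V _ G _ hδ hiso
    rcases Nat.eq_zero_or_pos G.maxDegree with h0 | hpos
    -- For Δ = 0 the claimed bound is 0, since r - 1 > 0, so the strength itself has to vanish.
    · have hbot : ∀ u v, ¬ G.Adj u v := by
        intro u v huv
        have := ((G.degree_pos_iff_exists_adj u).2 ⟨v, huv⟩).trans_le (G.degree_le_maxDegree u)
        omega
      obtain ⟨k', h3, h4⟩ := G.distantIrregularityStrength_le (r := r) (k := 0) ⟨fun _ => 0, by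
        intro e
        induction e using Sym2.ind with
        | _ x y => exact fun h => absurd h (hbot x y), by
        intro u v huv
        obtain ⟨p, -⟩ := exists_walk_of_edist_ne_top
          (ne_top_of_le_ne_top (ENat.natCast_ne_top r) huv.2)
        cases p with
        | nil => exact absurd rfl huv.1
        | cons h _ => exact absurd h (hbot _ _)⟩
      refine ⟨k', h3, ?_⟩
      rw [h0, Nat.le_zero.1 h4]
      simp [show r - 1 ≠ 0 by omega]
    · have hP1 : (1 : ℝ) ≤ (G.maxDegree : ℝ) ^ (r - 1) := one_le_pow₀ (by exact_mod_cast hpos)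
      by_cases hΔ : Δ₀ ≤ G.maxDegree
      · obtain ⟨k, h1, h2⟩ := hlarge V G hΔ hδ
        refine ⟨k, h1, h2.le.trans ?_⟩
        dsimp only
        rw [if_pos hΔ]
        have h3 : (G.maxDegree : ℝ) ≤ (G.maxDegree : ℝ) ^ (r - 1) :=
          le_self_pow₀ (by exact_mod_cast hpos) (by omega)
        have h4 : (12 : ℝ) ≤ 12 / G.maxDegree * (G.maxDegree : ℝ) ^ (r - 1) := by
          rw [div_mul_eq_mul_div, le_div_iff₀ (by exact_mod_cast hpos)]
          linarith
        have e : (4 + (4 / Real.log (G.maxDegree : ℝ) + 12 / G.maxDegree)) *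
            (G.maxDegree : ℝ) ^ (r - 1) = 4 * (G.maxDegree : ℝ) ^ (r - 1) *
            (1 + 1 / Real.log (G.maxDegree : ℝ)) +
            12 / G.maxDegree * (G.maxDegree : ℝ) ^ (r - 1) := by ring
        rw [e]
        linarith
      · obtain ⟨k, h1, h2⟩ := G.distantIrregularityStrength_le
          (G.exists_isDistantIrregularColoring_of_noIsolatedEdges r hiso)
        refine ⟨k, h1, ?_⟩
        dsimp only
        rw [if_neg hΔ]
        have h3 : (k : ℝ) ≤ 2 ^ Fintype.card (Sym2 (Fin (G.maxDegree * G.maxDegree ^ r + 1))) := by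
          exact_mod_cast h2
        have h4 : (0 : ℝ) ≤ 2 ^ Fintype.card (Sym2 (Fin (G.maxDegree * G.maxDegree ^ r + 1))) := by
          positivity
        nlinarith
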